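/- Let $C$ be a positively oriented simple loop in the complex plane, that is, a rectifiable simple closed curve given by an absolutely continuous parametrization on $[0,1]$ (for instance a piecewise $C^1$ one), which winds exactly once counterclockwise around each point of the open region $D$ that it encloses ($D$ is the set of points off $C$ lying in a bounded component of $\mathbb{C}\setminus C$). Let $z_0\in D$, and let $G$ be analytic in $D\setminus\{z_0\}$ and continuous on $\overline{D}\setminus\{z_0\}$, with a pole of order $p\ge 1$ at $z_0$. Let $\{g_j\}_{j=-\infty}^{\infty}$ be the Laurent coefficients of $G$ at $z_0$ (so $g_j=0$ for $j<-p$), so that for some $r_0>0$ $$G(z)=\sum_{j=-p}^{\infty} g_j (z-z_0)^j \qquad (0<|z-z_0|<r_0).$$ Let $G^*$ denote the regular part of $G$ at $z_0$, that is, $G^*(z)=G(z)-\sum_{j=1}^{p} g_{-j}(z-z_0)^{-j}$ for $z\ne z_0$, and $G^*(z_0)=g_0$. Then $$G^*(z)=\sum_{j=0}^{\infty} g_j (z-z_0)^j \qquad (0\le |z-z_0|<r_0),$$ $G^*$ is analytic in $D$, and for every $z\in D$ (including $z=z_0$) the contour integral below exists and $$\oint_C \frac{G(t)}{t-z}\,dt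 = 2\pi i\, G^*(z).$$ -/

import Mathlib

namespace ContourCauchy

/-- A closed path `C : [0, 1] → ℂ` is a simple loop: it is injective apart from `C 0 = C 1`. -/
def IsSimpleLoop {x : ℂ} (C : Path x x) : Prop :=
  Set.InjOn C (Set.Ico 0 1)

/-- The open region enclosed by a loop: the points off the loop whose connected component in the
complement of the loop is bounded. -/
def inside {x : ℂ} (C : Path x x) : Set ℂ :=
  {z | z ∉ Set.range C ∧ Bornology.IsBounded (connectedComponentIn (Set.range C)ᶜ z)}

/-- The loop `C` winds `n` times around `w`: along some continuous branch `L` of `log (C - w)`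
the total increment is `2πi n`. -/
def HasWindingNumber {x : ℂ} (C : Path x x) (w : ℂ) (n : ℤ) : Prop :=
  ∃ L : unitInterval → ℂ, Continuous L ∧ (∀ t, C t - w = Complex.exp (L t)) ∧
    L 1 - L 0 = 2 * Real.pi * Complex.I * n

/-- A loop is positively oriented if it winds exactly once, counterclockwise, around every
point that it encloses. -/
def IsPositivelyOriented {x : ℂ} (C : Path x x) : Prop :=
  ∀ w ∈ inside C, HasWindingNumber C w 1

/-- The one-form `f(t) dt`. -/
noncomputable def dform (f : ℂ → ℂ) : ℂ → ℂ →L[ℂ] ℂ :=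
  fun t => f t • ContinuousLinearMap.id ℂ ℂ

/-- The numbers `g j`, `j ∈ ℤ`, are the coefficients of a Laurent expansion
`G z = ∑_{j ≥ -p} g j (z - z₀)^j`, valid for `0 < |z - z₀| < r`. -/
structure IsLaurentExpansion (G : ℂ → ℂ) (z₀ : ℂ) (p : ℕ) (g : ℤ → ℂ) (r : ℝ) : Prop where
  coeff_eq_zero : ∀ j : ℤ, j < -(p : ℤ) → g j = 0
  hasSum : ∀ z : ℂ, 0 < ‖z - z₀‖ → ‖z - z₀‖ < r →
    HasSum (fun j : ℤ => g j * (z - z₀) ^ j) (G z)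

/-- The regular part of `G` at a pole `z₀` of order `p` with Laurent coefficients `g`: the function
`G` minus its principal part `∑_{j=1}^p g_{-j} (z - z₀)^{-j}`, with the value `g 0` at `z₀`. -/
noncomputable def regularPart (G : ℂ → ℂ) (z₀ : ℂ) (p : ℕ) (g : ℤ → ℂ) (z : ℂ) : ℂ :=
  open Classical in
  if z = z₀ then g 0 else G z - ∑ j ∈ Finset.Icc 1 p, g (-(j : ℤ)) / (z - z₀) ^ j

end ContourCauchy

/-! On the loop, `G` is its regular part plus the principal part. The regular part is holomorphic in
`inside C` and continuous on the closure, so it obeys Cauchy's integral formula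
(`integral_div_sub_mul_deriv`). A principal term divided by `t - z` contributes nothing: by partial
fractions its integral reduces to two winding integrals that cancel and to powers that have
primitives (`integral_inv_pow_div_sub_mul_deriv`).

The core is Cauchy's theorem for `F` merely continuous up to a rectifiable loop, obtained without
the Jordan curve theorem. Let `I` be the contour integral of `F`, and let `J` be the same integral
with `F` replaced by its integral over the disc of radius `δ` about each point. If `F` oscillates by
at most `ε` at scale `δ`, then `J` is within `O(ε δ²)` of `π δ² I`. By Fubini, `2πi J` is the area
integral over `w` of the integral of `F` around the circle of radius `δ` about `w`, times the
winding integral of the loop at `w`. That product vanishes when the disc lies inside (Cauchy for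
discs) and when `w` lies outside (winding number zero). What remains is a `δ`-neighbourhood of the
loop, of area `O(δ)`, on which the product is `O(δ ε)`. Hence `J = O(ε δ²)` and `I = O(ε)`.

This first requires `F` continuous with compact support on the plane. Tietze extension removes that
restriction once the loop is known to lie in the closure of its inside
(`range_subset_closure_inside`), which itself follows from the restricted form of Cauchy's theorem.
-/

open MeasureTheory Set Filter Topology

/-! ### Absolutely continuous complex-valued functions. -/

namespace AbsolutelyContinuousOnInterval

variable {γ : ℝ → ℂ} {a b : ℝ}

theorem _root_.LipschitzOnWith.comp_absolutelyContinuousOnInterval {X Y : Type*}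
    [PseudoMetricSpace X] [PseudoMetricSpace Y] {φ : X → Y} {f : ℝ → X} {K : NNReal} {s : Set X}
    (hφ : LipschitzOnWith K φ s) (hf : AbsolutelyContinuousOnInterval f a b)
    (hs : MapsTo f (uIcc a b) s) : AbsolutelyContinuousOnInterval (φ ∘ f) a b := by
  rw [absolutelyContinuousOnInterval_iff] at hf ⊢
  intro ε hε
  -- `K + 1` instead of `K` allows `K = 0` and makes the final inequality strict.
  obtain ⟨δ, hδ, H⟩ := hf (ε / (K + 1)) (by positivity)
  refine ⟨δ, hδ, fun E hE hlt ↦ ?_⟩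
  have h1 := H E hE hlt
  calc ∑ i ∈ Finset.range E.1, dist ((φ ∘ f) (E.2 i).1) ((φ ∘ f) (E.2 i).2)
      ≤ ∑ i ∈ Finset.range E.1, K * dist (f (E.2 i).1) (f (E.2 i).2) :=
        Finset.sum_le_sum fun i hi ↦
          hφ.dist_le_mul _ (hs (hE.1 i hi).1) _ (hs (hE.1 i hi).2)
    _ = K * ∑ i ∈ Finset.range E.1, dist (f (E.2 i).1) (f (E.2 i).2) := by
        rw [Finset.mul_sum]
    _ ≤ K * (ε / (K + 1)) := by gcongr
    _ < ε := by
        rw [mul_div_assoc', div_lt_iff₀ (by positivity)]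
        nlinarith

theorem congr {X : Type*} [PseudoMetricSpace X] {f g : ℝ → X}
    (hf : AbsolutelyContinuousOnInterval f a b) (hfg : EqOn f g (uIcc a b)) :
    AbsolutelyContinuousOnInterval g a b := by
  rw [absolutelyContinuousOnInterval_iff] at hf ⊢
  intro ε hε
  obtain ⟨δ, hδ, H⟩ := hf ε hε
  refine ⟨δ, hδ, fun E hE hlt ↦ (Finset.sum_congr rfl fun i hi ↦ ?_).trans_lt (H E hE hlt)⟩
  rw [hfg (hE.1 i hi).1, hfg (hE.1 i hi).2]

theorem re (h : AbsolutelyContinuousOnInterval γ a b) :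
    AbsolutelyContinuousOnInterval (fun t ↦ (γ t).re) a b :=
  ((Complex.reCLM.lipschitz.lipschitzOnWith (s := univ)).comp_absolutelyContinuousOnInterval h
    (mapsTo_univ _ _))

theorem im (h : AbsolutelyContinuousOnInterval γ a b) :
    AbsolutelyContinuousOnInterval (fun t ↦ (γ t).im) a b :=
  ((Complex.imCLM.lipschitz.lipschitzOnWith (s := univ)).comp_absolutelyContinuousOnInterval h
    (mapsTo_univ _ _))

theorem of_re_im (h1 : AbsolutelyContinuousOnInterval (fun t ↦ (γ t).re) a b)
    (h2 : AbsolutelyContinuousOnInterval (fun t ↦ (γ t).im) a b) :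
    AbsolutelyContinuousOnInterval γ a b := by
  have e1 := (Complex.ofRealCLM.lipschitz.lipschitzOnWith
    (s := univ)).comp_absolutelyContinuousOnInterval h1 (mapsTo_univ _ _)
  have e2 := (Complex.ofRealCLM.lipschitz.lipschitzOnWith
    (s := univ)).comp_absolutelyContinuousOnInterval h2 (mapsTo_univ _ _)
  have e3 := e1.add (e2.const_smul Complex.I)
  have e4 : γ = (Complex.ofRealCLM ∘ fun t ↦ (γ t).re) +
      fun t ↦ Complex.I • (Complex.ofRealCLM ∘ fun t ↦ (γ t).im) t := by
    ext t
    simpa [mul_comm] using (Complex.re_add_im (γ t)).symm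
  rw [e4]
  exact e3

theorem ae_differentiableAt_complex (h : AbsolutelyContinuousOnInterval γ a b) :
    ∀ᵐ t, t ∈ uIcc a b → DifferentiableAt ℝ γ t :=
  h.boundedVariationOn.ae_differentiableAt_of_mem_uIcc

theorem intervalIntegrable_deriv_complex (h : AbsolutelyContinuousOnInterval γ a b) :
    IntervalIntegrable (deriv γ) volume a b := by
  have e1 : IntervalIntegrable (fun t ↦ ((deriv (fun t ↦ (γ t).re) t : ℝ) : ℂ)) volume a b :=
    ⟨h.re.intervalIntegrable_deriv.1.ofReal, h.re.intervalIntegrable_deriv.2.ofReal⟩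
  have e2 : IntervalIntegrable (fun t ↦ ((deriv (fun t ↦ (γ t).im) t : ℝ) : ℂ)) volume a b :=
    ⟨h.im.intervalIntegrable_deriv.1.ofReal, h.im.intervalIntegrable_deriv.2.ofReal⟩
  refine (e1.add (e2.mul_const Complex.I)).congr_ae ?_
  refine (ae_restrict_iff' measurableSet_uIoc).2 ?_
  filter_upwards [h.ae_differentiableAt_complex] with t ht hm
  have d := (ht (uIoc_subset_uIcc hm)).hasDerivAt
  have d1 : HasDerivAt (fun t ↦ (γ t).re) (deriv γ t).re t :=
    Complex.reCLM.hasFDerivAt.comp_hasDerivAt t d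
  have d2 : HasDerivAt (fun t ↦ (γ t).im) (deriv γ t).im t :=
    Complex.imCLM.hasFDerivAt.comp_hasDerivAt t d
  simp only [d1.deriv, d2.deriv]
  exact Complex.re_add_im _

theorem _root_.IntervalIntegrable.absolutelyContinuousOnInterval_integral_complex {f : ℝ → ℂ}
    (h : IntervalIntegrable f volume a b) :
    AbsolutelyContinuousOnInterval (fun s ↦ ∫ t in a..s, f t) a b := by
  have key : ∀ s ∈ uIcc a b, IntervalIntegrable f volume a s := fun s hs ↦
    h.mono_set (uIcc_subset_uIcc_left hs)
  have hre : IntervalIntegrable (fun t ↦ (f t).re) volume a b := ⟨h.1.re, h.2.re⟩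
  have him : IntervalIntegrable (fun t ↦ (f t).im) volume a b := ⟨h.1.im, h.2.im⟩
  refine of_re_im ?_ ?_
  · refine (hre.absolutelyContinuousOnInterval_intervalIntegral
      left_mem_uIcc).congr fun s hs ↦ ?_
    exact Complex.reCLM.intervalIntegral_comp_comm (key s hs)
  · refine (him.absolutelyContinuousOnInterval_intervalIntegral
      left_mem_uIcc).congr fun s hs ↦ ?_
    exact Complex.imCLM.intervalIntegral_comp_comm (key s hs)

/-- The fundamental theorem of calculus for absolutely continuous complex-valued functions. -/
theorem integral_eq_sub_of_ae_hasDerivAt {f : ℝ → ℂ} (h : AbsolutelyContinuousOnInterval γ a b)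
    (hf : ∀ᵐ t, t ∈ uIcc a b → HasDerivAt γ (f t) t) :
    ∫ t in a..b, f t = γ b - γ a := by
  have hi : IntervalIntegrable f volume a b := by
    refine h.intervalIntegrable_deriv_complex.congr_ae ?_
    refine (ae_restrict_iff' measurableSet_uIoc).2 ?_
    filter_upwards [hf] with t ht hm using (ht (uIoc_subset_uIcc hm)).deriv
  -- The difference between `γ` and the integral of `f` is absolutely continuous with zero
  -- derivative almost everywhere, hence constant.
  have hac := h.sub hi.absolutelyContinuousOnInterval_integral_complex
  obtain ⟨c, hc⟩ := hac.const_of_ae_hasDerivAt_zero (by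
    filter_upwards [hf, hi.ae_hasDerivAt_integral] with t h1 h2 hm
    simpa using (h1 hm).sub (h2 hm a left_mem_uIcc))
  have ha := hc a left_mem_uIcc
  have hb := hc b right_mem_uIcc
  simp only [Pi.sub_apply, intervalIntegral.integral_same, sub_zero] at ha hb
  rw [ha, ← hb]
  ring

theorem contDiff_comp {φ : ℂ → ℂ} (hφ : ContDiff ℝ 1 φ)
    (h : AbsolutelyContinuousOnInterval γ a b) : AbsolutelyContinuousOnInterval (φ ∘ γ) a b := by
  obtain ⟨R, hR⟩ := h.exists_bound
  obtain ⟨K, hK⟩ := (hφ.contDiffOn (s := Metric.closedBall 0 R)).exists_lipschitzOnWith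
    (by decide) (convex_closedBall _ _) (isCompact_closedBall _ _)
  exact hK.comp_absolutelyContinuousOnInterval h fun t ht ↦ by simpa using hR t ht

theorem complex_mul {f : ℝ → ℂ} (hf : AbsolutelyContinuousOnInterval f a b)
    (h : AbsolutelyContinuousOnInterval γ a b) :
    AbsolutelyContinuousOnInterval (fun t ↦ f t * γ t) a b :=
  hf.smul h

/-- The curve is compact and misses `w`, so it stays at distance at least some `d > 0` from `w`,
where inversion is Lipschitz with constant `d⁻²`. -/
theorem inv_sub {w : ℂ} (h : AbsolutelyContinuousOnInterval γ a b)
    (hw : w ∉ γ '' uIcc a b) : AbsolutelyContinuousOnInterval (fun t ↦ (γ t - w)⁻¹) a b := by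
  have hcl : IsClosed (γ '' uIcc a b) := (isCompact_uIcc.image_of_continuousOn h.continuousOn).isClosed
  obtain ⟨d, hd, hball⟩ := Metric.isOpen_iff.1 hcl.isOpen_compl w hw
  have hlip : LipschitzOnWith (Real.toNNReal (d⁻¹ * d⁻¹)) (fun z : ℂ ↦ (z - w)⁻¹)
      (γ '' uIcc a b) := by
    have hfar : ∀ z ∈ γ '' uIcc a b, d ≤ ‖z - w‖ := fun z hz ↦ by
      by_contra! hlt
      exact hball (by simpa [dist_eq_norm] using hlt) hz
    refine LipschitzOnWith.of_dist_le_mul fun x hx y hy ↦ ?_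
    have hx' := hfar x hx
    have hy' := hfar y hy
    have hx0 : x - w ≠ 0 := norm_pos_iff.1 (hd.trans_le hx')
    have hy0 : y - w ≠ 0 := norm_pos_iff.1 (hd.trans_le hy')
    rw [Real.coe_toNNReal _ (by positivity), dist_eq_norm, dist_eq_norm, inv_sub_inv hx0 hy0,
      norm_div, norm_mul, sub_sub_sub_cancel_right, norm_sub_rev, div_eq_mul_inv, mul_comm, mul_inv]
    gcongr
  exact hlip.comp_absolutelyContinuousOnInterval h (mapsTo_image _ _)

end AbsolutelyContinuousOnInterval

/-! ### Winding integrals. -/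

theorem IsPreconnected.eq_of_exp_eq_one {X : Type*} [TopologicalSpace X] {S : Set X}
    (hS : IsPreconnected S) {f : X → ℂ} (hf : ContinuousOn f S)
    (h : ∀ x ∈ S, Complex.exp (f x) = 1) {x y : X} (hx : x ∈ S) (hy : y ∈ S) : f x = f y := by
  have h' : ∀ x, ∃ n : ℤ, x ∈ S → f x = n * (2 * Real.pi * Complex.I) := fun x ↦ by
    by_cases hx : x ∈ S
    · obtain ⟨n, hn⟩ := Complex.exp_eq_one_iff.1 (h x hx)
      exact ⟨n, fun _ ↦ hn⟩
    · exact ⟨0, fun h ↦ (hx h).elim⟩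
  choose n hn using h'
  have hpi : (2 * Real.pi * Complex.I) ≠ 0 := Complex.two_pi_I_ne_zero
  have hc : ContinuousOn (fun x ↦ ((n x : ℤ) : ℝ)) S := by
    have : ContinuousOn (fun x ↦ (f x / (2 * Real.pi * Complex.I)).re) S :=
      Complex.continuous_re.comp_continuousOn (hf.div_const _)
    refine this.congr fun x hx ↦ ?_
    simp only [hn x hx]
    rw [mul_div_cancel_right₀ _ hpi, Complex.intCast_re]
  have hc' : ContinuousOn n S := Int.isClosedEmbedding_coe_real.isInducing.continuousOn_iff.2 hc
  rw [hn x hx, hn y hy, hS.constant hc' hx hy]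

namespace ContourCauchy

/-- The integral of `dz / (z - w)` along `γ : [0, 1] → ℂ`. -/
noncomputable def windingIntegral (γ : ℝ → ℂ) (w : ℂ) : ℂ :=
  ∫ t in (0 : ℝ)..1, deriv γ t / (γ t - w)

variable {γ : ℝ → ℂ} {w : ℂ}

theorem uIcc_zero_one : uIcc (0 : ℝ) 1 = Icc 0 1 := uIcc_of_le zero_le_one

theorem intervalIntegrable_mul_deriv (hγ : AbsolutelyContinuousOnInterval γ 0 1) {f : ℂ → ℂ}
    (hf : ContinuousOn f (γ '' Icc 0 1)) :
    IntervalIntegrable (fun t ↦ f (γ t) * deriv γ t) volume 0 1 := by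
  refine hγ.intervalIntegrable_deriv_complex.continuousOn_mul ?_
  rw [uIcc_zero_one]
  exact hf.comp (uIcc_zero_one ▸ hγ.continuousOn) (mapsTo_image _ _)

theorem continuousOn_inv_sub {s : Set ℂ} (hw : w ∉ s) : ContinuousOn (fun z ↦ (z - w)⁻¹) s :=
  ContinuousOn.inv₀ (by fun_prop) fun z hz h0 ↦ hw (sub_eq_zero.1 h0 ▸ hz)

theorem intervalIntegrable_deriv_div (hγ : AbsolutelyContinuousOnInterval γ 0 1)
    (hw : w ∉ γ '' Icc 0 1) :
    IntervalIntegrable (fun t ↦ deriv γ t / (γ t - w)) volume 0 1 := by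
  simpa [div_eq_inv_mul] using intervalIntegrable_mul_deriv hγ (continuousOn_inv_sub hw)

/-- The function `(γ s - w) * exp (-∫₀ˢ γ' / (γ - w))` is absolutely continuous with derivative zero
almost everywhere, so it keeps its value at `0`. -/
theorem exp_integral_deriv_div (hγ : AbsolutelyContinuousOnInterval γ 0 1)
    (hw : w ∉ γ '' Icc 0 1) {s : ℝ} (hs : s ∈ Icc (0 : ℝ) 1) :
    Complex.exp (∫ t in (0 : ℝ)..s, deriv γ t / (γ t - w)) = (γ s - w) / (γ 0 - w) := by
  have hi := intervalIntegrable_deriv_div hγ hw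
  have hI := hi.absolutelyContinuousOnInterval_integral_complex
  have hne : ∀ t ∈ Icc (0 : ℝ) 1, γ t - w ≠ 0 := fun t ht h0 ↦
    hw ⟨t, ht, sub_eq_zero.1 h0⟩
  have hE : AbsolutelyContinuousOnInterval
      (fun s ↦ (γ s - w) * Complex.exp (-∫ t in (0 : ℝ)..s, deriv γ t / (γ t - w))) 0 1 := by
    refine AbsolutelyContinuousOnInterval.complex_mul ?_ ?_
    · exact hγ.contDiff_comp (φ := fun z ↦ z - w) (by fun_prop)
    · exact hI.contDiff_comp (φ := fun z ↦ Complex.exp (-z))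
        (Complex.contDiff_exp.comp contDiff_neg)
  obtain ⟨c, hc⟩ := hE.const_of_ae_hasDerivAt_zero (by
    filter_upwards [hγ.ae_differentiableAt_complex, hi.ae_hasDerivAt_integral] with t h1 h2 hm
    have d1 := (h1 hm).hasDerivAt.sub_const w
    have d2 := (h2 hm 0 left_mem_uIcc).neg.cexp
    have d3 := d1.mul d2
    convert! d3 using 1
    have := hne t (uIcc_zero_one ▸ hm)
    field_simp
    ring)
  have h0 := hc 0 left_mem_uIcc
  have h1 := hc s (uIcc_zero_one ▸ hs)
  simp only [intervalIntegral.integral_same, neg_zero, Complex.exp_zero, mul_one] at h0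
  rw [eq_div_iff (hne 0 ⟨le_rfl, zero_le_one⟩), h0, ← h1, mul_comm, mul_assoc, ← Complex.exp_add,
    neg_add_cancel, Complex.exp_zero, mul_one]

theorem windingIntegral_eq_of_log (hγ : AbsolutelyContinuousOnInterval γ 0 1) {L : ℝ → ℂ}
    (hL : ContinuousOn L (Icc 0 1)) (h : ∀ t ∈ Icc (0 : ℝ) 1, γ t - w = Complex.exp (L t)) :
    windingIntegral γ w = L 1 - L 0 := by
  have hw : w ∉ γ '' Icc 0 1 := by
    rintro ⟨t, ht, rfl⟩
    exact Complex.exp_ne_zero (L t) (by simpa using (h t ht).symm)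
  have hI := (intervalIntegrable_deriv_div hγ hw).absolutelyContinuousOnInterval_integral_complex
  have hIc := hI.continuousOn
  rw [uIcc_zero_one] at hIc
  have l0 : (0 : ℝ) ∈ Icc (0 : ℝ) 1 := ⟨le_rfl, zero_le_one⟩
  have l1 : (1 : ℝ) ∈ Icc (0 : ℝ) 1 := ⟨zero_le_one, le_rfl⟩
  have key := (isPreconnected_Icc (a := (0 : ℝ)) (b := 1)).eq_of_exp_eq_one
    (f := fun s ↦ L s - L 0 - ∫ t in (0 : ℝ)..s, deriv γ t / (γ t - w))
    ((hL.sub continuousOn_const).sub hIc) (fun s hs ↦ by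
      rw [Complex.exp_sub, Complex.exp_sub, exp_integral_deriv_div hγ hw hs, ← h s hs, ← h 0 l0]
      have a1 : γ s - w ≠ 0 := h s hs ▸ Complex.exp_ne_zero _
      have a0 : γ 0 - w ≠ 0 := h 0 l0 ▸ Complex.exp_ne_zero _
      field_simp) l1 l0
  simp only [intervalIntegral.integral_same, sub_self] at key
  rw [windingIntegral]
  exact (sub_eq_zero.1 key).symm

theorem exp_windingIntegral (hγ : AbsolutelyContinuousOnInterval γ 0 1) (hcl : γ 0 = γ 1)
    (hw : w ∉ γ '' Icc 0 1) : Complex.exp (windingIntegral γ w) = 1 := by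
  rw [windingIntegral, exp_integral_deriv_div hγ hw ⟨zero_le_one, le_rfl⟩, ← hcl, div_self]
  exact fun h0 ↦ hw ⟨0, ⟨le_rfl, zero_le_one⟩, sub_eq_zero.1 h0⟩

theorem norm_windingIntegral_le (hγ : AbsolutelyContinuousOnInterval γ 0 1) {d : ℝ} (hd : 0 < d)
    (h : ∀ z ∈ γ '' Icc 0 1, d ≤ ‖z - w‖) :
    ‖windingIntegral γ w‖ ≤ (∫ t in (0 : ℝ)..1, ‖deriv γ t‖) / d := by
  rw [← intervalIntegral.integral_div]
  refine intervalIntegral.norm_integral_le_of_norm_le zero_le_one (ae_of_all _ fun t ht ↦ ?_)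
    (hγ.intervalIntegrable_deriv_complex.norm.div_const d)
  rw [norm_div]
  have := h (γ t) ⟨t, ⟨ht.1.le, ht.2⟩, rfl⟩
  gcongr

theorem continuousOn_windingIntegral (hγ : AbsolutelyContinuousOnInterval γ 0 1) :
    ContinuousOn (windingIntegral γ) (γ '' Icc 0 1)ᶜ := by
  intro w hw
  refine ContinuousAt.continuousWithinAt ?_
  have hcl : IsClosed (γ '' Icc 0 1) :=
    (isCompact_Icc.image_of_continuousOn (uIcc_zero_one ▸ hγ.continuousOn)).isClosed
  obtain ⟨d, hd, hball⟩ := Metric.isOpen_iff.1 hcl.isOpen_compl w hw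
  have hfar : ∀ z ∈ γ '' Icc 0 1, ∀ v ∈ Metric.ball w (d / 2), d / 2 ≤ ‖z - v‖ := by
    intro z hz v hv
    by_contra! hlt
    refine hball ?_ hz
    rw [Metric.mem_ball] at hv ⊢
    rw [← dist_eq_norm] at hlt
    linarith [dist_triangle z v w]
  have hb : Metric.ball w (d / 2) ∈ 𝓝 w := Metric.ball_mem_nhds _ (by positivity)
  refine intervalIntegral.continuousAt_of_dominated_interval
    (bound := fun t ↦ ‖deriv γ t‖ / (d / 2)) ?_ ?_ ?_ ?_
  · filter_upwards [hb] with v hv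
    refine (intervalIntegrable_deriv_div hγ fun hm ↦ ?_).aestronglyMeasurable_restrict_uIoc
    have := hfar v hm v hv
    simp only [sub_self, norm_zero] at this
    linarith
  · filter_upwards [hb] with v hv
    refine ae_of_all _ fun t ht ↦ ?_
    rw [uIoc_of_le zero_le_one] at ht
    have := hfar (γ t) ⟨t, ⟨ht.1.le, ht.2⟩, rfl⟩ v hv
    rw [norm_div]
    gcongr
  · exact hγ.intervalIntegrable_deriv_complex.norm.div_const _
  · refine ae_of_all _ fun t ht ↦ ?_
    rw [uIoc_of_le zero_le_one] at ht
    refine ContinuousAt.div (by fun_prop) (by fun_prop) fun h0 ↦ ?_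
    exact hw ⟨t, ⟨ht.1.le, ht.2⟩, sub_eq_zero.1 h0⟩

/-- For a closed curve the winding integral takes values in `2πiℤ` and is continuous off the curve,
so it is constant on the component. It also decays like length over distance, and the component
contains points arbitrarily far away. -/
theorem windingIntegral_eq_zero_of_not_isBounded (hγ : AbsolutelyContinuousOnInterval γ 0 1)
    (hcl : γ 0 = γ 1) (hw : w ∉ γ '' Icc 0 1)
    (hub : ¬ Bornology.IsBounded (connectedComponentIn (γ '' Icc 0 1)ᶜ w)) :
    windingIntegral γ w = 0 := by
  set S := connectedComponentIn (γ '' Icc 0 1)ᶜ w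
  have hS : S ⊆ (γ '' Icc 0 1)ᶜ := connectedComponentIn_subset _ _
  have hconst : ∀ v ∈ S, windingIntegral γ w = windingIntegral γ v := fun v hv ↦
    isPreconnected_connectedComponentIn.eq_of_exp_eq_one
      ((continuousOn_windingIntegral hγ).mono hS)
      (fun x hx ↦ exp_windingIntegral hγ hcl (hS hx)) (mem_connectedComponentIn hw) hv
  obtain ⟨R, hR⟩ := hγ.exists_bound
  rw [uIcc_zero_one] at hR
  by_contra hne
  have hpos : 0 < ‖windingIntegral γ w‖ := norm_pos_iff.2 hne
  set l := ∫ t in (0 : ℝ)..1, ‖deriv γ t‖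
  have hl : 0 ≤ l := intervalIntegral.integral_nonneg zero_le_one fun _ _ ↦ norm_nonneg _
  -- At distance `d` the bound `l / d` is already smaller than the norm of the winding integral.
  set d := l / ‖windingIntegral γ w‖ + 1
  have hd : 0 < d := by positivity
  refine hub ((Metric.isBounded_closedBall (x := (0 : ℂ)) (r := R + d)).subset fun v hv ↦ ?_)
  by_contra hv'
  rw [mem_closedBall_zero_iff, not_le] at hv'
  have h1 := norm_windingIntegral_le (w := v) hγ hd (by
    rintro _ ⟨t, ht, rfl⟩
    have h2 := hR t ht
    have h3 := norm_sub_norm_le v (γ t)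
    rw [norm_sub_rev] at h3
    linarith)
  rw [← hconst v hv, le_div_iff₀ hd] at h1
  have h4 : ‖windingIntegral γ w‖ * d = l + ‖windingIntegral γ w‖ := by
    simp only [d]
    field_simp
  rw [h4] at h1
  linarith

theorem image_extend_Icc {x : ℂ} (C : Path x x) : C.extend '' Icc 0 1 = range C := by
  ext z
  constructor
  · rintro ⟨t, ht, rfl⟩
    exact ⟨⟨t, ht⟩, (C.extend_apply ht).symm⟩
  · rintro ⟨t, rfl⟩
    exact ⟨t, t.2, by simp⟩

theorem HasWindingNumber.windingIntegral_eq {x : ℂ} {C : Path x x} {n : ℤ}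
    (h : HasWindingNumber C w n) (hC : AbsolutelyContinuousOnInterval C.extend 0 1) :
    windingIntegral C.extend w = 2 * Real.pi * Complex.I * n := by
  obtain ⟨L, hL, hexp, hinc⟩ := h
  rw [windingIntegral_eq_of_log hC (L := IccExtend zero_le_one L) (by fun_prop)
    (fun t ht ↦ ?_), ← hinc]
  · simp [IccExtend_right, IccExtend_left]
  · rw [IccExtend_of_mem _ _ ht, C.extend_apply ht]
    exact hexp _

theorem windingIntegral_eq_zero {x : ℂ} {C : Path x x}
    (hC : AbsolutelyContinuousOnInterval C.extend 0 1) (hw : w ∉ range C) (hw' : w ∉ inside C) :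
    windingIntegral C.extend w = 0 := by
  rw [← image_extend_Icc] at hw
  refine windingIntegral_eq_zero_of_not_isBounded hC (by simp) hw fun hb ↦ hw' ?_
  rw [image_extend_Icc] at hb hw
  exact ⟨hw, hb⟩

/-! ### Topology of the inside of a loop. -/

theorem isOpen_inside {x : ℂ} (C : Path x x) : IsOpen (inside C) := by
  have hK : IsOpen (range C)ᶜ := (isCompact_range C.continuous).isClosed.isOpen_compl
  rw [isOpen_iff_mem_nhds]
  intro z hz
  filter_upwards [hK.connectedComponentIn.mem_nhds (mem_connectedComponentIn hz.1)] with w hw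
  refine ⟨connectedComponentIn_subset _ _ hw, ?_⟩
  rw [← connectedComponentIn_eq hw]
  exact hz.2

/-- A connected set off the loop that meets the inside of the loop lies in it. -/
theorem subset_inside {x : ℂ} {C : Path x x} {S : Set ℂ} (hS : IsPreconnected S)
    (hd : Disjoint S (range C)) (hw : w ∈ S) (hin : w ∈ inside C) : S ⊆ inside C := by
  intro v hv
  have hsub : S ⊆ (range C)ᶜ := disjoint_left.1 hd
  refine ⟨hsub hv, ?_⟩
  have := hS.subset_connectedComponentIn hw hsub hv
  rw [← connectedComponentIn_eq this]
  exact hin.2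

theorem isBounded_inside {x : ℂ} (C : Path x x) : Bornology.IsBounded (inside C) := by
  obtain ⟨R, hR0, hR⟩ :=
    (isCompact_range C.continuous).isBounded.subset_closedBall_lt 0 (0 : ℂ)
  refine (Metric.isBounded_closedBall (x := (0 : ℂ)) (r := R)).subset fun z hz ↦ ?_
  by_contra hz'
  rw [mem_closedBall_zero_iff, not_le] at hz'
  -- A point outside a disc containing the loop has an unbounded component, since the radial ray
  -- from it to infinity avoids the loop.
  have hray : (fun s : ℝ ↦ s • z) '' Ici 1 ⊆ connectedComponentIn (range C)ᶜ z := by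
    refine IsPreconnected.subset_connectedComponentIn
      (isPreconnected_Ici.image _ (by fun_prop)) ⟨1, self_mem_Ici, one_smul _ _⟩ ?_
    rintro _ ⟨s, hs, rfl⟩ hm
    have h1 := mem_closedBall_zero_iff.1 (hR hm)
    rw [norm_smul, Real.norm_of_nonneg (zero_le_one.trans hs)] at h1
    have hs' : 1 ≤ s := hs
    nlinarith
  obtain ⟨R', hR0', hR'⟩ := (hz.2.subset hray).subset_closedBall_lt 0 (0 : ℂ)
  have h1 := mem_closedBall_zero_iff.1 (hR' ⟨R' / R + 1, by
    simpa using (div_pos hR0' hR0).le, rfl⟩)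
  rw [norm_smul, Real.norm_of_nonneg (by positivity)] at h1
  have h2 : (R' / R + 1) * R = R' + R := by field_simp
  have h3 : 0 < R' / R + 1 := by positivity
  nlinarith

end ContourCauchy

/-! ### Area of neighbourhoods of a rectifiable curve. -/

/-- The thickenings of a curve of finite length have area `O(δ)`. -/
theorem BoundedVariationOn.exists_volume_thickening_le {γ : ℝ → ℂ}
    (h : BoundedVariationOn γ (Icc 0 1)) :
    ∃ c : ℝ, 0 ≤ c ∧ ∀ δ : ℝ, 0 < δ → δ ≤ 1 →
      volume (Metric.thickening δ (γ '' Icc 0 1)) ≤ ENNReal.ofReal (c * δ) := by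
  set V : ℝ → ℝ := variationOnFromTo γ (Icc 0 1) 0
  have h0 : (0 : ℝ) ∈ Icc (0 : ℝ) 1 := ⟨le_rfl, zero_le_one⟩
  have h1 : (1 : ℝ) ∈ Icc (0 : ℝ) 1 := ⟨zero_le_one, le_rfl⟩
  have hloc := h.locallyBoundedVariationOn
  have hV0 : ∀ t ∈ Icc (0 : ℝ) 1, 0 ≤ V t := fun t ht ↦ variationOnFromTo.nonneg_of_le _ _ ht.1
  have hVm : MonotoneOn V (Icc 0 1) := variationOnFromTo.monotoneOn hloc h0
  have hdist : ∀ s ∈ Icc (0 : ℝ) 1, ∀ t ∈ Icc (0 : ℝ) 1, dist (γ s) (γ t) ≤ |V s - V t| := by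
    have aux : ∀ s ∈ Icc (0 : ℝ) 1, ∀ t ∈ Icc (0 : ℝ) 1, s ≤ t →
        dist (γ s) (γ t) ≤ V t - V s := fun s hs t ht hst ↦ by
      rw [variationOnFromTo.sub_right hloc h0 ht hs, variationOnFromTo.eq_of_le _ _ hst, dist_edist]
      exact ENNReal.toReal_mono (hloc s t hs ht)
        (eVariationOn.edist_le _ ⟨hs, le_rfl, hst⟩ ⟨ht, hst, le_rfl⟩)
    intro s hs t ht
    rcases le_total s t with hst | hst
    · rw [abs_sub_comm]
      exact (aux s hs t ht hst).trans (le_abs_self _)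
    · rw [dist_comm]
      exact (aux t ht s hs hst).trans (le_abs_self _)
  set l := V 1
  have hl : 0 ≤ l := hV0 1 h1
  refine ⟨(l + 1) * (4 * Real.pi), by positivity, fun δ hδ hδ1 ↦ ?_⟩
  -- Cut the curve into pieces of length at most `δ`, measured by the variation `V`. Each piece lies
  -- in a disc of radius `δ`, so doubling the radius covers the thickening.
  have hcov : ∀ k : ℕ, ∃ z : ℂ, ∀ t ∈ Icc (0 : ℝ) 1, ⌊V t / δ⌋₊ = k → dist (γ t) z ≤ δ := fun k ↦ by
    by_cases hk : ∃ s ∈ Icc (0 : ℝ) 1, ⌊V s / δ⌋₊ = k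
    · obtain ⟨s, hs, hsk⟩ := hk
      refine ⟨γ s, fun t ht htk ↦ (hdist t ht s hs).trans ?_⟩
      have a1 := Nat.floor_le (div_nonneg (hV0 s hs) hδ.le)
      have a2 := Nat.lt_floor_add_one (V s / δ)
      have b1 := Nat.floor_le (div_nonneg (hV0 t ht) hδ.le)
      have b2 := Nat.lt_floor_add_one (V t / δ)
      rw [hsk] at a1 a2
      rw [htk] at b1 b2
      rw [le_div_iff₀ hδ] at a1 b1
      rw [div_lt_iff₀ hδ] at a2 b2
      rw [abs_le]
      constructor <;> linarith
    · exact ⟨0, fun t ht htk ↦ (hk ⟨t, ht, htk⟩).elim⟩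
  choose z hz using hcov
  have hsub : Metric.thickening δ (γ '' Icc 0 1) ⊆
      ⋃ k ∈ Finset.range (⌊l / δ⌋₊ + 1), Metric.ball (z k) (2 * δ) := by
    intro w hw
    obtain ⟨_, ⟨t, ht, rfl⟩, hwt⟩ := Metric.mem_thickening_iff.1 hw
    refine mem_iUnion₂.2 ⟨⌊V t / δ⌋₊, ?_, ?_⟩
    · rw [Finset.mem_range, Nat.lt_succ_iff]
      gcongr
      exact hVm ht h1 ht.2
    · rw [Metric.mem_ball]
      linarith [dist_triangle w (γ t) (z ⌊V t / δ⌋₊), hz _ t ht rfl]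
  calc volume (Metric.thickening δ (γ '' Icc 0 1))
      ≤ ∑ k ∈ Finset.range (⌊l / δ⌋₊ + 1), volume (Metric.ball (z k) (2 * δ)) :=
        (measure_mono hsub).trans (measure_biUnion_finset_le _ _)
    _ = ENNReal.ofReal ((⌊l / δ⌋₊ + 1) * ((2 * δ) ^ 2 * Real.pi)) := by
        simp only [Complex.volume_ball, Finset.sum_const, Finset.card_range, nsmul_eq_mul]
        rw [ENNReal.ofReal_mul (p := (⌊l / δ⌋₊ : ℝ) + 1) (by positivity),
          ENNReal.ofReal_mul (p := (2 * δ) ^ 2) (by positivity),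
          ENNReal.ofReal_pow (by positivity), ENNReal.ofReal_mul (p := 2) (by positivity),
          ← NNReal.coe_real_pi, ENNReal.ofReal_coe_nnreal, ← Nat.cast_succ, ENNReal.ofReal_natCast]
    _ ≤ ENNReal.ofReal ((l + 1) * (4 * Real.pi) * δ) := by
        refine ENNReal.ofReal_le_ofReal ?_
        have a1 := Nat.floor_le (div_nonneg hl hδ.le)
        have a2 : (⌊l / δ⌋₊ + 1) * δ ≤ l + 1 := by
          rw [le_div_iff₀ hδ] at a1
          linarith
        have : ((⌊l / δ⌋₊ : ℝ) + 1) * ((2 * δ) ^ 2 * Real.pi) =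
          ((⌊l / δ⌋₊ + 1) * δ) * (4 * Real.pi) * δ := by ring
        rw [this]
        gcongr

theorem BoundedVariationOn.volume_image_eq_zero {γ : ℝ → ℂ}
    (h : BoundedVariationOn γ (Icc 0 1)) : volume (γ '' Icc 0 1) = 0 := by
  obtain ⟨c, hc, H⟩ := h.exists_volume_thickening_le
  refine le_antisymm (ge_of_tendsto (x := 𝓝[>] (0 : ℝ)) (f := fun δ ↦ ENNReal.ofReal (c * δ)) ?_ ?_)
    zero_le
  · have : Tendsto (fun δ : ℝ ↦ ENNReal.ofReal (c * δ)) (𝓝 0) (𝓝 (ENNReal.ofReal (c * 0))) :=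
      ENNReal.tendsto_ofReal (tendsto_const_nhds.mul tendsto_id)
    rw [mul_zero, ENNReal.ofReal_zero] at this
    exact this.mono_left nhdsWithin_le_nhds
  · filter_upwards [Ioc_mem_nhdsGT zero_lt_one] with δ hδ
    exact (measure_mono (Metric.self_subset_thickening hδ.1 _)).trans (H δ hδ.1 hδ.2)

/-! ### The Cauchy kernel and Fubini's theorem. -/

theorem Complex.integrableOn_norm_inv_ball :
    IntegrableOn (fun w : ℂ ↦ ‖w‖⁻¹) (Metric.ball 0 1) := by
  -- In polar coordinates the Jacobian `y` cancels `y⁻¹`.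
  refine (integrableOn_fun_norm_addHaar volume (f := fun y : ℝ ↦ y⁻¹)).2 ?_
  rw [Complex.finrank_real_complex]
  have : IntegrableOn (fun _ : ℝ ↦ (1 : ℝ)) (Ioo 0 1) := by simp
  refine this.congr_fun (fun y hy ↦ ?_) measurableSet_Ioo
  simp [hy.1.ne']

/-- The kernel `1 / (w - a)` is locally integrable in `w`, uniformly in `a`. -/
theorem HasCompactSupport.integrable_div_sub {H : ℂ → ℂ} (hs : HasCompactSupport H)
    (hH : Continuous H) :
    ∃ K : ℝ, ∀ a : ℂ, Integrable (fun w ↦ H w / (w - a)) ∧ ∫ w, ‖H w / (w - a)‖ ≤ K := by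
  obtain ⟨M, hM⟩ := hs.exists_bound_of_continuous hH
  have hM0 : 0 ≤ M := (norm_nonneg _).trans (hM 0)
  set k : ℂ → ℝ := (Metric.ball (0 : ℂ) 1).indicator fun w ↦ ‖w‖⁻¹
  have hk : Integrable k :=
    (integrable_indicator_iff Metric.isOpen_ball.measurableSet).2 Complex.integrableOn_norm_inv_ball
  have hHi : Integrable H := hH.integrable_of_hasCompactSupport hs
  refine ⟨(M * ∫ w, k w) + ∫ w, ‖H w‖, fun a ↦ ?_⟩
  have hka : Integrable fun w ↦ M * k (w - a) := (hk.comp_sub_right a).const_mul M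
  -- The two terms serve `w` within distance `1` of `a` and the other `w`; their integrals do not
  -- depend on `a`.
  have hbd : ∀ w, ‖H w / (w - a)‖ ≤ M * k (w - a) + ‖H w‖ := fun w ↦ by
    rw [norm_div, div_eq_mul_inv]
    by_cases hw : w - a ∈ Metric.ball (0 : ℂ) 1
    · simp only [k, indicator_of_mem hw]
      have := hM w
      have h1 : ‖H w‖ * ‖w - a‖⁻¹ ≤ M * ‖w - a‖⁻¹ := by gcongr
      linarith [norm_nonneg (H w)]
    · simp only [k, indicator_of_notMem hw, mul_zero, zero_add]
      rw [mem_ball_zero_iff, not_lt] at hw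
      exact mul_le_of_le_one_right (norm_nonneg _) (inv_le_one_of_one_le₀ hw)
  have hi : Integrable (fun w ↦ H w / (w - a)) :=
    (hka.add hHi.norm).mono' (by
      refine Measurable.aestronglyMeasurable ?_
      exact hH.measurable.div (measurable_id.sub_const a)) (ae_of_all _ hbd)
  refine ⟨hi, (integral_mono hi.norm (hka.add hHi.norm) hbd).trans_eq ?_⟩
  simp only [Pi.add_apply]
  rw [integral_add hka hHi.norm, integral_const_mul, integral_sub_right_eq_self (μ := volume) k a]

theorem HasCompactSupport.integrable_prod_div_sub {T : Type*} [MeasurableSpace T] {ν : Measure T}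
    [SFinite ν] {g a : T → ℂ} (hg : Integrable g ν) (ha : Measurable a) {H : ℂ → ℂ}
    (hs : HasCompactSupport H) (hH : Continuous H) :
    Integrable (fun q : T × ℂ ↦ g q.1 * (H q.2 / (q.2 - a q.1))) (ν.prod volume) := by
  obtain ⟨K, hK⟩ := hs.integrable_div_sub hH
  have hm : AEStronglyMeasurable (fun q : T × ℂ ↦ g q.1 * (H q.2 / (q.2 - a q.1)))
      (ν.prod volume) := by
    refine hg.aestronglyMeasurable.comp_fst.mul (Measurable.aestronglyMeasurable ?_)
    exact (hH.measurable.comp measurable_snd).div (measurable_snd.sub (ha.comp measurable_fst))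
  refine (integrable_prod_iff hm).2 ⟨ae_of_all _ fun t ↦ (hK (a t)).1.const_mul (g t), ?_⟩
  refine (hg.norm.mul_const K).mono' hm.norm.integral_prod_right' (ae_of_all _ fun t ↦ ?_)
  simp only [norm_mul]
  rw [integral_const_mul, norm_mul, norm_norm, Real.norm_of_nonneg
    (integral_nonneg fun _ ↦ norm_nonneg _)]
  gcongr
  exact (hK (a t)).2

theorem continuous_circleIntegral {F : ℂ → ℂ} (hF : Continuous F) (δ : ℝ) :
    Continuous fun w ↦ ∮ ζ in C(w, δ), F ζ := by
  simp only [circleIntegral, deriv_circleMap]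
  refine intervalIntegral.continuous_parametric_intervalIntegral_of_continuous' ?_ _ _
  have h1 : Continuous fun p : ℂ × ℝ ↦ circleMap p.1 δ p.2 := by
    unfold circleMap
    fun_prop
  have h2 : Continuous fun p : ℂ × ℝ ↦ circleMap 0 δ p.2 := by
    unfold circleMap
    fun_prop
  exact (h2.mul continuous_const).smul (hF.comp h1)

theorem HasCompactSupport.circleIntegral {F : ℂ → ℂ} (hs : HasCompactSupport F) {δ : ℝ}
    (hδ : 0 ≤ δ) : HasCompactSupport fun w ↦ ∮ ζ in C(w, δ), F ζ := by
  obtain ⟨R, hR⟩ := hs.isCompact.isBounded.subset_closedBall (0 : ℂ)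
  refine HasCompactSupport.intro (isCompact_closedBall (0 : ℂ) (R + δ)) fun w hw ↦ ?_
  rw [mem_closedBall_zero_iff, not_le] at hw
  rw [circleIntegral.integral_congr (g := fun _ ↦ 0) hδ fun ζ hζ ↦ ?_]
  · simp [_root_.circleIntegral]
  · refine image_eq_zero_of_notMem_tsupport fun hm ↦ ?_
    have h1 := mem_closedBall_zero_iff.1 (hR hm)
    have h2 : ‖ζ - w‖ = δ := by simpa [dist_eq_norm] using hζ
    have h3 := norm_sub_norm_le w ζ
    rw [norm_sub_rev] at h3
    linarith

/-- Translating `w` by the point of the circle moves the circle from the argument of `F` to the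
kernel. There it gives minus the integral of `1 / (ζ - w)` around the circle centred at `z`, which
is `-2πi` for `w` in the disc and `0` beyond it. -/
theorem integral_circleIntegral_div {F : ℂ → ℂ} (hF : Continuous F) (hs : HasCompactSupport F)
    {δ : ℝ} (hδ : 0 < δ) (z : ℂ) :
    ∫ w, (∮ ζ in C(w, δ), F ζ) / (w - z) =
      -(2 * Real.pi * Complex.I) * ∫ w in Metric.ball z δ, F w := by
  set ν : Measure ℝ := volume.restrict (Ioc 0 (2 * Real.pi))
  have h2pi : (0 : ℝ) ≤ 2 * Real.pi := by positivity
  set u : ℝ → ℂ := circleMap 0 δ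
  have hu : Continuous u := continuous_circleMap _ _
  set g : ℝ → ℂ := fun θ ↦ u θ * Complex.I
  have hg : Integrable g ν :=
    ((hu.mul continuous_const).integrableOn_Icc (a := 0) (b := 2 * Real.pi)).mono_set
      Ioc_subset_Icc_self
  have hint := hs.integrable_prod_div_sub (a := fun θ ↦ z + u θ) hg (by fun_prop) hF
  -- This shear performs the translation for all angles at once and carries integrability over to
  -- the untranslated kernel.
  have hmp : MeasurePreserving (fun q : ℝ × ℂ ↦ (q.1, q.2 + u q.1)) (ν.prod volume)
      (ν.prod volume) :=
    (MeasurePreserving.id ν).skew_product (g := fun θ w ↦ w + u θ) (by fun_prop)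
      (ae_of_all _ fun θ ↦ (measurePreserving_add_right volume (u θ)).map_eq)
  have hint' : Integrable (fun q : ℝ × ℂ ↦ g q.1 * (F (q.2 + u q.1) / (q.2 - z)))
      (ν.prod volume) := by
    have := hmp.integrable_comp_of_integrable hint
    refine this.congr (ae_of_all _ fun q ↦ ?_)
    simp only [Function.comp]
    congr 2
    ring
  have hkernel : ∀ w, w ∉ Metric.sphere z δ →
      ∫ θ, g θ * (F w / (w - (z + u θ))) ∂ν =
        (Metric.ball z δ).indicator (fun w ↦ -(2 * Real.pi * Complex.I) * F w) w := fun w hw ↦ by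
    have e1 : ∫ θ, g θ * (F w / (w - (z + u θ))) ∂ν =
        -(∮ ζ in C(z, δ), (ζ - w)⁻¹) * F w := by
      rw [circleIntegral, intervalIntegral.integral_of_le h2pi, ← integral_neg,
        ← integral_mul_const]
      refine integral_congr_ae (ae_of_all _ fun θ ↦ ?_)
      simp only [deriv_circleMap, smul_eq_mul, g, u]
      rw [show circleMap z δ θ = z + circleMap 0 δ θ by simp [circleMap], ← neg_sub w, inv_neg]
      ring
    rw [e1]
    by_cases hin : w ∈ Metric.ball z δ
    · rw [indicator_of_mem hin, circleIntegral.integral_sub_inv_of_mem_ball hin]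
    · rw [indicator_of_notMem hin]
      have hw' : w ∉ Metric.closedBall z δ := fun h ↦ by
        rw [← Metric.ball_union_sphere] at h
        exact h.elim hin hw
      have hd : DifferentiableOn ℂ (fun ζ ↦ (ζ - w)⁻¹) (Metric.closedBall z δ) :=
        DifferentiableOn.inv (by fun_prop) fun ζ hζ h0 ↦ hw' (sub_eq_zero.1 h0 ▸ hζ)
      rw [DiffContOnCl.circleIntegral_eq_zero hδ.le, neg_zero, zero_mul]
      exact (hd.mono Metric.closure_ball_subset_closedBall).diffContOnCl
  calc ∫ w, (∮ ζ in C(w, δ), F ζ) / (w - z)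
      = ∫ w, ∫ θ, g θ * (F (w + u θ) / (w - z)) ∂ν := by
        refine integral_congr_ae (ae_of_all _ fun w ↦ ?_)
        simp only [circleIntegral]
        rw [intervalIntegral.integral_of_le h2pi, ← integral_div]
        refine integral_congr_ae (ae_of_all _ fun θ ↦ ?_)
        simp only [deriv_circleMap, smul_eq_mul, g, u]
        rw [show circleMap w δ θ = w + circleMap 0 δ θ by simp [circleMap], mul_div_assoc]
    _ = ∫ θ, (∫ w, g θ * (F (w + u θ) / (w - z))) ∂ν :=
        (integral_integral_swap hint').symm
    _ = ∫ θ, (∫ w, g θ * (F w / (w - (z + u θ)))) ∂ν := by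
        refine integral_congr_ae (ae_of_all _ fun θ ↦ ?_)
        simp only
        rw [← integral_add_right_eq_self (μ := volume)
          (fun w ↦ g θ * (F w / (w - (z + u θ)))) (u θ)]
        refine integral_congr_ae (ae_of_all _ fun w ↦ ?_)
        simp only
        congr 2
        ring
    _ = ∫ w, ∫ θ, g θ * (F w / (w - (z + u θ))) ∂ν := integral_integral_swap hint
    _ = ∫ w, (Metric.ball z δ).indicator (fun w ↦ -(2 * Real.pi * Complex.I) * F w) w := by
        refine integral_congr_ae ?_
        filter_upwards [measure_eq_zero_iff_ae_notMem.1
          (Measure.addHaar_sphere (volume : Measure ℂ) z δ)] with w hw using hkernel w hw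
    _ = _ := by
        rw [integral_indicator Metric.isOpen_ball.measurableSet, integral_const_mul]

namespace ContourCauchy

theorem integral_integral_ball_mul_deriv {γ : ℝ → ℂ} (hc : Continuous γ)
    (hγ : AbsolutelyContinuousOnInterval γ 0 1) {F : ℂ → ℂ} (hF : Continuous F)
    (hs : HasCompactSupport F) {δ : ℝ} (hδ : 0 < δ) :
    2 * Real.pi * Complex.I * ∫ t in (0 : ℝ)..1, (∫ w in Metric.ball (γ t) δ, F w) * deriv γ t =
      ∫ w, (∮ ζ in C(w, δ), F ζ) * windingIntegral γ w := by
  have hg : Integrable (deriv γ) (volume.restrict (Ioc 0 1)) :=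
    hγ.intervalIntegrable_deriv_complex.1
  have hint := (hs.circleIntegral hδ.le).integrable_prod_div_sub hg hc.measurable
    (continuous_circleIntegral hF δ)
  calc _ = -∫ t in Ioc (0 : ℝ) 1, ∫ w, deriv γ t * ((∮ ζ in C(w, δ), F ζ) / (w - γ t)) := by
        rw [intervalIntegral.integral_of_le zero_le_one, ← integral_const_mul, ← integral_neg]
        refine integral_congr_ae (ae_of_all _ fun t ↦ ?_)
        simp only
        rw [integral_const_mul, integral_circleIntegral_div hF hs hδ]
        ring
    _ = -∫ w, ∫ t in Ioc (0 : ℝ) 1, deriv γ t * ((∮ ζ in C(w, δ), F ζ) / (w - γ t)) := by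
        rw [integral_integral_swap hint]
    _ = _ := by
        rw [← integral_neg]
        refine integral_congr_ae (ae_of_all _ fun w ↦ ?_)
        simp only
        rw [windingIntegral, intervalIntegral.integral_of_le zero_le_one, ← integral_const_mul,
          ← integral_neg]
        refine integral_congr_ae (ae_of_all _ fun t ↦ ?_)
        simp only
        rw [← neg_sub w, div_neg]
        ring

end ContourCauchy

/-! ### Averages and circle integrals over small discs. -/

theorem Complex.volume_real_ball (z : ℂ) {δ : ℝ} (hδ : 0 ≤ δ) :
    volume.real (Metric.ball z δ) = Real.pi * δ ^ 2 := by
  rw [measureReal_def, Complex.volume_ball, ENNReal.toReal_mul, ENNReal.toReal_pow,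
    ENNReal.toReal_ofReal hδ, mul_comm]
  rfl

theorem continuous_setIntegral_ball {F : ℂ → ℂ} (hF : Continuous F) (hs : HasCompactSupport F)
    (δ : ℝ) : Continuous fun z ↦ ∫ w in Metric.ball z δ, F w := by
  obtain ⟨M, hM⟩ := hs.exists_bound_of_continuous hF
  have h : (fun z ↦ ∫ w in Metric.ball z δ, F w) =
      fun z ↦ ∫ w in Metric.ball 0 δ, F (w + z) := by
    ext z
    rw [← integral_indicator Metric.isOpen_ball.measurableSet,
      ← integral_indicator Metric.isOpen_ball.measurableSet,
      ← integral_add_right_eq_self (μ := volume) ((Metric.ball z δ).indicator F) z]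
    refine integral_congr_ae (ae_of_all _ fun w ↦ ?_)
    simp [indicator, dist_eq_norm]
  rw [h]
  have : IsFiniteMeasure (volume.restrict (Metric.ball (0 : ℂ) δ)) :=
    ⟨by rw [Measure.restrict_apply_univ]; exact measure_ball_lt_top⟩
  refine continuous_of_dominated (bound := fun _ ↦ M) (fun z ↦ ?_)
    (fun z ↦ ae_of_all _ fun w ↦ hM _) (integrable_const M) (ae_of_all _ fun w ↦ ?_)
  · exact (Continuous.aestronglyMeasurable (by fun_prop))
  · fun_prop

theorem norm_setIntegral_ball_sub_le {F : ℂ → ℂ} (hF : Continuous F) {δ ε : ℝ} (hδ : 0 < δ)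
    (z : ℂ) (h : ∀ w, dist w z ≤ δ → ‖F w - F z‖ ≤ ε) :
    ‖(∫ w in Metric.ball z δ, F w) - Real.pi * δ ^ 2 * F z‖ ≤ ε * (Real.pi * δ ^ 2) := by
  have hlt : volume (Metric.ball z δ) < ⊤ := measure_ball_lt_top
  have hint : IntegrableOn F (Metric.ball z δ) :=
    (hF.continuousOn.integrableOn_compact (isCompact_closedBall z δ)).mono_set
      Metric.ball_subset_closedBall
  have e : (∫ w in Metric.ball z δ, F w) - Real.pi * δ ^ 2 * F z =
      ∫ w in Metric.ball z δ, (F w - F z) := by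
    rw [integral_sub hint (integrableOn_const hlt.ne), setIntegral_const,
      Complex.volume_real_ball z hδ.le]
    simp
  rw [e, ← Complex.volume_real_ball z hδ.le]
  exact norm_setIntegral_le_of_norm_le_const hlt fun w hw ↦ h w (Metric.mem_ball.1 hw).le

theorem norm_circleIntegral_le_of_norm_sub_le {F : ℂ → ℂ} (hF : Continuous F) {δ ε : ℝ}
    (hδ : 0 < δ) (z : ℂ) (h : ∀ w, dist w z ≤ δ → ‖F w - F z‖ ≤ ε) :
    ‖∮ ζ in C(z, δ), F ζ‖ ≤ 2 * Real.pi * δ * ε := by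
  -- The constant `F z` integrates to zero around the circle, so only the oscillation of `F` counts.
  have e : ∮ ζ in C(z, δ), F ζ = ∮ ζ in C(z, δ), (F ζ - F z) := by
    rw [circleIntegral.integral_sub (hF.continuousOn.circleIntegrable hδ.le)
      (circleIntegrable_const _ _ _), circleIntegral.integral_eq_zero_of_hasDerivWithinAt
      (f := fun ζ ↦ ζ * F z) (f' := fun _ ↦ F z) hδ.le, sub_zero]
    intro ζ _
    simpa using ((hasDerivAt_id ζ).mul_const (F z)).hasDerivWithinAt
  rw [e]
  exact circleIntegral.norm_integral_le_of_norm_le_const hδ.le fun w hw ↦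
    h w (Metric.mem_sphere.1 hw).le

/-! ### Cauchy's theorem for compactly supported continuous functions. -/

namespace ContourCauchy

theorem norm_circleIntegral_mul_windingIntegral_le {x : ℂ} {C : Path x x}
    (hrect : AbsolutelyContinuousOnInterval C.extend 0 1) (hpos : IsPositivelyOriented C)
    {F : ℂ → ℂ} (hF : Continuous F) (hd : DifferentiableOn ℂ F (inside C)) {δ ε : ℝ}
    (hδ : 0 < δ) (hε : 0 ≤ ε) (h : ∀ z w, dist w z ≤ δ → ‖F w - F z‖ ≤ ε) {w : ℂ}
    (hw : w ∉ range C) :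
    ‖(∮ ζ in C(w, δ), F ζ) * windingIntegral C.extend w‖ ≤
      (Metric.thickening δ (range C)).indicator
        (fun _ ↦ 2 * Real.pi * δ * ε * (2 * Real.pi)) w := by
  by_cases hin : w ∈ inside C
  · rw [(hpos w hin).windingIntegral_eq hrect]
    by_cases hth : w ∈ Metric.thickening δ (range C)
    · rw [indicator_of_mem hth, norm_mul]
      have h1 := norm_circleIntegral_le_of_norm_sub_le hF hδ w (h w)
      have h2 : ‖2 * Real.pi * Complex.I * ((1 : ℤ) : ℂ)‖ = 2 * Real.pi := by
        simp [abs_of_pos Real.pi_pos]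
      rw [h2]
      gcongr
    · have hball : Metric.ball w δ ⊆ inside C := by
        refine subset_inside Metric.isPreconnected_ball ?_ (Metric.mem_ball_self hδ) hin
        refine disjoint_left.2 fun z hz hzC ↦ hth (Metric.mem_thickening_iff.2 ⟨z, hzC, ?_⟩)
        rwa [dist_comm]
      rw [DiffContOnCl.circleIntegral_eq_zero hδ.le ⟨hd.mono hball, hF.continuousOn⟩, zero_mul,
        norm_zero]
      exact indicator_nonneg (fun _ _ ↦ by positivity) _
  · rw [windingIntegral_eq_zero hrect hw hin, mul_zero, norm_zero]
    exact indicator_nonneg (fun _ _ ↦ by positivity) _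

/-- Cauchy's theorem for a rectifiable loop and a continuous function on the plane that is
holomorphic inside the loop. -/
theorem integral_eq_zero_of_hasCompactSupport {x : ℂ} {C : Path x x}
    (hrect : AbsolutelyContinuousOnInterval C.extend 0 1) (hpos : IsPositivelyOriented C)
    {F : ℂ → ℂ} (hF : Continuous F) (hs : HasCompactSupport F)
    (hd : DifferentiableOn ℂ F (inside C)) :
    ∫ t in (0 : ℝ)..1, F (C.extend t) * deriv C.extend t = 0 := by
  set γ := C.extend
  have hγ : Continuous γ := C.continuous_extend
  have hbv := hrect.boundedVariationOn
  rw [uIcc_zero_one] at hbv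
  obtain ⟨c, hc, hvol⟩ := hbv.exists_volume_thickening_le
  have hnull := hbv.volume_image_eq_zero
  rw [image_extend_Icc] at hnull hvol
  set l := ∫ t in (0 : ℝ)..1, ‖deriv γ t‖
  have hl : 0 ≤ l := intervalIntegral.integral_nonneg zero_le_one fun _ _ ↦ norm_nonneg _
  set I := ∫ t in (0 : ℝ)..1, F (γ t) * deriv γ t
  suffices H : ∀ ε > 0, ‖I‖ ≤ ε * (l + 2 * c) by
    have ht : Tendsto (fun ε : ℝ ↦ ε * (l + 2 * c)) (𝓝[>] 0) (𝓝 0) := by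
      have : Tendsto (fun ε : ℝ ↦ ε * (l + 2 * c)) (𝓝 0) (𝓝 (0 * (l + 2 * c))) :=
        tendsto_id.mul_const _
      rw [zero_mul] at this
      exact this.mono_left nhdsWithin_le_nhds
    exact norm_le_zero_iff.1 (ge_of_tendsto ht (eventually_mem_nhdsWithin.mono fun ε hε ↦ H ε hε))
  intro ε hε
  obtain ⟨δ', hδ', huc⟩ := Metric.uniformContinuous_iff.1 (hs.uniformContinuous_of_continuous hF) ε hε
  -- `δ` must lie below the modulus of uniform continuity, and below `1` for the area bound.
  obtain ⟨δ, hδ, hδlt⟩ := exists_between (lt_min hδ' one_pos)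
  have hδ1 : δ ≤ 1 := hδlt.le.trans (min_le_right _ _)
  have hosc : ∀ z w, dist w z ≤ δ → ‖F w - F z‖ ≤ ε := fun z w hzw ↦ by
    rw [← dist_eq_norm]
    exact (huc (hzw.trans_lt (hδlt.trans_le (min_le_left _ _)))).le
  set J := ∫ t in (0 : ℝ)..1, (∫ w in Metric.ball (γ t) δ, F w) * deriv γ t
  have hJI : ‖J - Real.pi * δ ^ 2 * I‖ ≤ ε * (Real.pi * δ ^ 2) * l := by
    have i1 := intervalIntegrable_mul_deriv hrect
      (continuous_setIntegral_ball hF hs δ).continuousOn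
    have i2 := intervalIntegrable_mul_deriv hrect hF.continuousOn
    rw [← intervalIntegral.integral_const_mul, ← intervalIntegral.integral_const_mul,
      ← intervalIntegral.integral_sub i1 (i2.const_mul _)]
    refine intervalIntegral.norm_integral_le_of_norm_le zero_le_one (ae_of_all _ fun t _ ↦ ?_)
      (hrect.intervalIntegrable_deriv_complex.norm.const_mul _)
    rw [← mul_assoc, ← sub_mul, norm_mul]
    gcongr
    exact norm_setIntegral_ball_sub_le hF hδ _ (hosc _)
  have hfin : volume (Metric.thickening δ (range C)) < ⊤ :=
    (hvol δ hδ hδ1).trans_lt ENNReal.ofReal_lt_top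
  have hmeas : MeasurableSet (Metric.thickening δ (range C)) :=
    Metric.isOpen_thickening.measurableSet
  have hJ : 2 * Real.pi * ‖J‖ ≤ 2 * Real.pi * δ * ε * (2 * Real.pi) * (c * δ) := by
    have e := integral_integral_ball_mul_deriv hγ hrect hF hs hδ
    have en : ‖2 * Real.pi * Complex.I * J‖ = 2 * Real.pi * ‖J‖ := by
      simp [abs_of_pos Real.pi_pos]
    rw [← en, e]
    refine (norm_integral_le_of_norm_le (g := (Metric.thickening δ (range C)).indicator
        (fun _ ↦ 2 * Real.pi * δ * ε * (2 * Real.pi))) ?_ ?_).trans ?_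
    · exact (integrable_indicator_iff hmeas).2 (integrableOn_const hfin.ne)
    · filter_upwards [measure_eq_zero_iff_ae_notMem.1 hnull] with w hw
      exact norm_circleIntegral_mul_windingIntegral_le hrect hpos hF hd hδ hε.le hosc hw
    · rw [integral_indicator hmeas, setIntegral_const, smul_eq_mul, mul_comm]
      gcongr
      exact ENNReal.toReal_le_of_le_ofReal (by positivity) (hvol δ hδ hδ1)
  have hpi := Real.pi_pos
  have hA : 0 < Real.pi * δ ^ 2 := by positivity
  have hJ' : ‖J‖ ≤ Real.pi * δ ^ 2 * (ε * (2 * c)) := by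
    refine le_of_mul_le_mul_left (hJ.trans_eq ?_) (by positivity : 0 < 2 * Real.pi)
    ring
  have hn : ‖(Real.pi * δ ^ 2 : ℂ) * I‖ = Real.pi * δ ^ 2 * ‖I‖ := by
    rw [norm_mul, norm_mul, norm_pow, Complex.norm_real, Complex.norm_real,
      Real.norm_of_nonneg hpi.le, Real.norm_of_nonneg hδ.le]
  have h3 := norm_sub_norm_le ((Real.pi * δ ^ 2 : ℂ) * I) J
  rw [norm_sub_rev, hn] at h3
  refine le_of_mul_le_mul_left ?_ hA
  linarith

end ContourCauchy

/-! ### The loop bounds its inside; Cauchy's theorem up to the boundary. -/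

namespace ContourCauchy

/-- Keeping `[a, b]` away from both endpoints makes the coincidence `C 0 = C 1` harmless. -/
theorem IsSimpleLoop.extend_mem_image_iff {x : ℂ} {C : Path x x} (hC : IsSimpleLoop C) {a b : ℝ}
    (ha : 0 < a) (hb : b < 1) {t : ℝ} (ht : t ∈ Ioc (0 : ℝ) 1) :
    C.extend t ∈ C.extend '' Icc a b ↔ t ∈ Icc a b := by
  have inj : ∀ s ∈ Ico (0 : ℝ) 1, ∀ t ∈ Ico (0 : ℝ) 1, C.extend s = C.extend t → s = t := by
    intro s hs t ht hst
    have hs' : s ∈ Icc (0 : ℝ) 1 := ⟨hs.1, hs.2.le⟩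
    have ht' : t ∈ Icc (0 : ℝ) 1 := ⟨ht.1, ht.2.le⟩
    rw [C.extend_apply hs', C.extend_apply ht'] at hst
    exact congrArg Subtype.val (hC (x₁ := ⟨s, hs'⟩) (x₂ := ⟨t, ht'⟩) ⟨hs.1, hs.2⟩ ⟨ht.1, ht.2⟩ hst)
  refine ⟨?_, fun h ↦ ⟨t, h, rfl⟩⟩
  rintro ⟨s, hs, hst⟩
  have hs' : s ∈ Ico (0 : ℝ) 1 := ⟨ha.le.trans hs.1, hs.2.trans_lt hb⟩
  rcases ht.2.lt_or_eq with h1 | rfl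
  · rwa [← inj s hs' t ⟨ht.1.le, h1⟩ hst]
  · have h0 : C.extend s = C.extend 0 := by simpa using hst
    have := inj s hs' 0 ⟨le_rfl, one_pos⟩ h0
    linarith [hs.1]

/-- Otherwise some nondegenerate arc `K` stays off the closure of the inside. Continuous functions
supported near `K` vanish inside, so their contour integrals are zero. Letting them tend to the
indicator of `K` shows that the endpoints of the arc coincide, contradicting simplicity. -/
theorem range_subset_closure_inside {x : ℂ} {C : Path x x}
    (hrect : AbsolutelyContinuousOnInterval C.extend 0 1) (hsimple : IsSimpleLoop C)
    (hpos : IsPositivelyOriented C) : range C ⊆ closure (inside C) := by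
  set γ := C.extend
  have hγ : Continuous γ := C.continuous_extend
  set U : Set ℝ := γ ⁻¹' (closure (inside C))ᶜ
  have hU : IsOpen U := isClosed_closure.isOpen_compl.preimage hγ
  rintro _ ⟨s, rfl⟩
  by_contra hs
  have hsU : (s : ℝ) ∈ U := by simpa [U, γ] using hs
  -- Even if `s` is an endpoint, the open set `U` contains interior parameters.
  have hcl : (s : ℝ) ∈ closure (Ioo (0 : ℝ) 1) := by
    rw [closure_Ioo zero_ne_one]
    exact s.2
  obtain ⟨r, hrU, hr⟩ := mem_closure_iff.1 hcl U hU hsU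
  obtain ⟨η, hη, hball⟩ := Metric.isOpen_iff.1 (hU.inter isOpen_Ioo) r ⟨hrU, hr⟩
  set b := r + η / 2
  have hrb : r < b := by simp only [b]; linarith
  have hsub : Icc r b ⊆ U ∩ Ioo 0 1 := fun t ht ↦ hball (by
    rw [Metric.mem_ball, Real.dist_eq, abs_of_nonneg (by linarith [ht.1])]
    have := ht.2
    simp only [b] at this
    linarith)
  have hb1 : b < 1 := (hsub ⟨hrb.le, le_rfl⟩).2.2
  set K := γ '' Icc r b
  have hK : IsCompact K := isCompact_Icc.image hγ
  have hKne : K.Nonempty := ⟨γ r, r, ⟨le_rfl, hrb.le⟩, rfl⟩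
  have hKD : K ⊆ (closure (inside C))ᶜ := by
    rintro _ ⟨t, ht, rfl⟩
    exact (hsub ht).1
  obtain ⟨d, hd, hthick⟩ := hK.exists_thickening_subset_open isClosed_closure.isOpen_compl hKD
  -- Tent functions: `1` on `K`, `0` at distance at least `1 / n` from it.
  set f : ℕ → ℂ → ℂ := fun n z ↦ ((max 0 (1 - n * Metric.infDist z K) : ℝ) : ℂ)
  have hfc : ∀ n, Continuous (f n) := fun n ↦ by
    have := Metric.continuous_infDist_pt K
    fun_prop
  have hf0 : ∀ (n : ℕ) z, 1 ≤ n * Metric.infDist z K → f n z = 0 := fun n z h ↦ by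
    simp only [f]
    rw [max_eq_left (by linarith), Complex.ofReal_zero]
  have hzero : ∀ᶠ n : ℕ in atTop, ∫ t in (0 : ℝ)..1, f n (γ t) * deriv γ t = 0 := by
    obtain ⟨N, hN⟩ := exists_nat_gt (1 / d)
    filter_upwards [eventually_ge_atTop (max N 1)] with n hn
    have hn1 : (1 : ℝ) ≤ n := by exact_mod_cast (le_max_right _ _).trans hn
    have hnN : (N : ℝ) ≤ n := by exact_mod_cast (le_max_left _ _).trans hn
    have hnd : 1 ≤ n * d := by
      rw [div_lt_iff₀ hd] at hN
      nlinarith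
    refine integral_eq_zero_of_hasCompactSupport hrect hpos (hfc n) ?_ ?_
    · refine HasCompactSupport.intro (hK.cthickening (r := 1)) fun z hz ↦ hf0 n z ?_
      by_contra! hlt
      refine hz (Metric.thickening_subset_cthickening _ _ ?_)
      rw [Metric.mem_thickening_iff_infDist_lt hKne]
      nlinarith [Metric.infDist_nonneg (x := z) (s := K)]
    · refine (differentiableOn_const (0 : ℂ)).congr fun z hz ↦ hf0 n z ?_
      have : z ∉ Metric.thickening d K := fun h ↦ hthick h (subset_closure hz)
      rw [Metric.mem_thickening_iff_infDist_lt hKne, not_lt] at this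
      have hn0 : (0 : ℝ) ≤ n := by positivity
      nlinarith
  have hlim : Tendsto (fun n ↦ ∫ t in (0 : ℝ)..1, f n (γ t) * deriv γ t) atTop
      (𝓝 (∫ t in (0 : ℝ)..1, (Icc r b).indicator (deriv γ) t)) := by
    refine intervalIntegral.tendsto_integral_filter_of_dominated_convergence
      (fun t ↦ ‖deriv γ t‖) (.of_forall fun n ↦ ?_) (.of_forall fun n ↦ ae_of_all _ fun t _ ↦ ?_)
      hrect.intervalIntegrable_deriv_complex.norm (ae_of_all _ fun t ht ↦ ?_)
    · exact (intervalIntegrable_mul_deriv hrect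
        (hfc n).continuousOn).aestronglyMeasurable_restrict_uIoc
    · rw [norm_mul]
      refine mul_le_of_le_one_left (norm_nonneg _) ?_
      simp only [f, Complex.norm_real]
      rw [Real.norm_of_nonneg (le_max_left _ _)]
      refine max_le zero_le_one ?_
      have : 0 ≤ n * Metric.infDist (γ t) K := mul_nonneg n.cast_nonneg Metric.infDist_nonneg
      linarith
    · rw [uIoc_of_le zero_le_one] at ht
      have hiff := hsimple.extend_mem_image_iff hr.1 hb1 ht
      refine tendsto_const_nhds.congr' ?_
      by_cases hm : t ∈ Icc r b
      · refine .of_forall fun n ↦ ?_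
        have : Metric.infDist (γ t) K = 0 := Metric.infDist_zero_of_mem (hiff.2 hm)
        simp [f, this, indicator_of_mem hm]
      · have hmK : γ t ∉ K := fun h ↦ hm (hiff.1 h)
        have hpos' := (hK.isClosed.notMem_iff_infDist_pos hKne).1 hmK
        obtain ⟨N, hN⟩ := exists_nat_gt (1 / Metric.infDist (γ t) K)
        filter_upwards [eventually_ge_atTop N] with n hn
        have hnN : (N : ℝ) ≤ n := by exact_mod_cast hn
        rw [div_lt_iff₀ hpos'] at hN
        rw [indicator_of_notMem hm, hf0 n _ (by nlinarith), zero_mul]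
  have heq := tendsto_nhds_unique hlim (tendsto_const_nhds.congr' (hzero.mono fun n h ↦ h.symm))
  have hsub' : Icc r b ⊆ Ioc 0 1 := fun t ht ↦ ⟨(hsub ht).2.1, (hsub ht).2.2.le⟩
  rw [intervalIntegral.integral_of_le zero_le_one, setIntegral_indicator measurableSet_Icc,
    inter_eq_right.2 hsub', integral_Icc_eq_integral_Ioc,
    ← intervalIntegral.integral_of_le hrb.le] at heq
  have hac : AbsolutelyContinuousOnInterval γ r b := hrect.mono (by
    rw [uIcc_of_le hrb.le, uIcc_zero_one]
    exact hsub'.trans Ioc_subset_Icc_self)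
  rw [hac.integral_eq_sub_of_ae_hasDerivAt (by
    filter_upwards [hac.ae_differentiableAt_complex] with t ht hm using (ht hm).hasDerivAt)] at heq
  have := (hsimple.extend_mem_image_iff (a := r) (b := r) hr.1 (hrb.trans hb1)
    (hsub' ⟨hrb.le, le_rfl⟩)).1 ⟨r, ⟨le_rfl, le_rfl⟩, (sub_eq_zero.1 heq).symm⟩
  exact absurd this.2 (not_le.2 hrb)

/-- **Cauchy's theorem** for a function continuous up to a rectifiable simple loop and holomorphic
inside it. -/
theorem integral_eq_zero_of_continuousOn {x : ℂ} {C : Path x x}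
    (hrect : AbsolutelyContinuousOnInterval C.extend 0 1) (hsimple : IsSimpleLoop C)
    (hpos : IsPositivelyOriented C) {F : ℂ → ℂ} (hF : ContinuousOn F (closure (inside C)))
    (hd : DifferentiableOn ℂ F (inside C)) :
    ∫ t in (0 : ℝ)..1, F (C.extend t) * deriv C.extend t = 0 := by
  obtain ⟨g, hg⟩ := ContinuousMap.exists_restrict_eq isClosed_closure
    (⟨_, hF.domRestrict⟩ : C(closure (inside C), ℂ))
  obtain ⟨R, hR⟩ := (isBounded_inside C).closure.subset_closedBall (0 : ℂ)
  -- A cutoff makes the Tietze extension `g` compactly supported without changing it on the closure.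
  set χ : ℂ → ℂ := fun z ↦ ((max 0 (min 1 (R + 1 - ‖z‖)) : ℝ) : ℂ)
  have hχ : ∀ z ∈ closure (inside C), χ z = 1 := fun z hz ↦ by
    have := mem_closedBall_zero_iff.1 (hR hz)
    simp only [χ]
    rw [min_eq_left (by linarith), max_eq_right zero_le_one, Complex.ofReal_one]
  have heq : EqOn (fun z ↦ g z * χ z) F (closure (inside C)) := fun z hz ↦ by
    simp only [hχ z hz, mul_one]
    exact congrArg (fun f : C(closure (inside C), ℂ) ↦ f ⟨z, hz⟩) hg
  have hcs : HasCompactSupport fun z ↦ g z * χ z := by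
    refine HasCompactSupport.intro (isCompact_closedBall (0 : ℂ) (R + 1)) fun z hz ↦ ?_
    rw [mem_closedBall_zero_iff, not_le] at hz
    simp only [χ]
    rw [max_eq_left ((min_le_right _ _).trans (by linarith)), Complex.ofReal_zero, mul_zero]
  have key := integral_eq_zero_of_hasCompactSupport hrect hpos
    (F := fun z ↦ g z * χ z) (by fun_prop) hcs (hd.congr (heq.mono subset_closure))
  rw [← key]
  refine intervalIntegral.integral_congr fun t ht ↦ ?_
  rw [uIcc_zero_one] at ht
  congr 1
  refine (heq (range_subset_closure_inside hrect hsimple hpos ?_)).symm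
  rw [← image_extend_Icc]
  exact ⟨t, ht, rfl⟩

end ContourCauchy

/-! ### Cauchy's integral formula and negative powers. -/

namespace ContourCauchy

section CurveIntegral

variable {x : ℂ} {C : Path x x}

theorem curveIntegral_dform (f : ℂ → ℂ) :
    curveIntegral (dform f) C = ∫ t in (0 : ℝ)..1, f (C.extend t) * deriv C.extend t := by
  rw [curveIntegral_eq_intervalIntegral_deriv]
  rfl

theorem curveIntegrable_dform (hrect : AbsolutelyContinuousOnInterval C.extend 0 1) {f : ℂ → ℂ}
    (hf : ContinuousOn f (range C)) : CurveIntegrable (dform f) C := by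
  rw [← image_extend_Icc] at hf
  refine (intervalIntegrable_mul_deriv hrect hf).congr_ae ?_
  -- Away from the endpoints, a null set, the one-sided and two-sided derivatives agree.
  rw [uIoc_of_le zero_le_one, ← restrict_Ioo_eq_restrict_Ioc]
  filter_upwards [ae_restrict_mem measurableSet_Ioo] with t ht
  rw [curveIntegralFun_def, derivWithin_of_mem_nhds (Icc_mem_nhds ht.1 ht.2)]
  rfl

theorem integral_inv_sub_mul_deriv (hrect : AbsolutelyContinuousOnInterval C.extend 0 1)
    (hpos : IsPositivelyOriented C) {z : ℂ} (hz : z ∈ inside C) :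
    ∫ t in (0 : ℝ)..1, (C.extend t - z)⁻¹ * deriv C.extend t = 2 * Real.pi * Complex.I := by
  have := (hpos z hz).windingIntegral_eq hrect
  rw [Int.cast_one, mul_one] at this
  rw [← this, windingIntegral]
  simp only [div_eq_inv_mul]

/-- **Cauchy's integral formula** for a function continuous up to a rectifiable simple loop and
holomorphic inside it. -/
theorem integral_div_sub_mul_deriv (hrect : AbsolutelyContinuousOnInterval C.extend 0 1)
    (hsimple : IsSimpleLoop C) (hpos : IsPositivelyOriented C) {F : ℂ → ℂ}
    (hF : ContinuousOn F (closure (inside C))) (hd : DifferentiableOn ℂ F (inside C)) {z : ℂ}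
    (hz : z ∈ inside C) :
    ∫ t in (0 : ℝ)..1, F (C.extend t) / (C.extend t - z) * deriv C.extend t =
      2 * Real.pi * Complex.I * F z := by
  have hnhds : inside C ∈ 𝓝 z := (isOpen_inside C).mem_nhds hz
  have hnhds' : closure (inside C) ∈ 𝓝 z := mem_of_superset hnhds subset_closure
  -- The difference quotient of `F` at `z`, completed by the derivative, is holomorphic inside and
  -- continuous up to the loop.
  have h0 := integral_eq_zero_of_continuousOn hrect hsimple hpos
    (F := dslope F z) ((continuousOn_dslope hnhds').2 ⟨hF, hd.differentiableAt hnhds⟩)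
    ((Complex.differentiableOn_dslope hnhds).2 hd)
  have hzC : z ∉ C.extend '' Icc 0 1 := image_extend_Icc C ▸ hz.1
  have i1 := (intervalIntegrable_mul_deriv hrect (continuousOn_inv_sub hzC)).const_mul (F z)
  have i2 := intervalIntegrable_mul_deriv hrect (f := fun t ↦ F t / (t - z)) (by
    refine ContinuousOn.div (hF.mono ?_) (by fun_prop) fun t ht h ↦ hzC (sub_eq_zero.1 h ▸ ht)
    rw [image_extend_Icc]
    exact range_subset_closure_inside hrect hsimple hpos)
  have e : ∫ t in (0 : ℝ)..1, dslope F z (C.extend t) * deriv C.extend t =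
      ∫ t in (0 : ℝ)..1, (F (C.extend t) / (C.extend t - z) * deriv C.extend t -
        F z * ((C.extend t - z)⁻¹ * deriv C.extend t)) := by
    refine intervalIntegral.integral_congr fun t ht ↦ ?_
    rw [uIcc_zero_one] at ht
    have hne : C.extend t ≠ z := fun h ↦ hzC ⟨t, ht, h⟩
    rw [dslope_of_ne _ hne, slope_def_field]
    ring
  rw [h0, intervalIntegral.integral_sub i2 i1, intervalIntegral.integral_const_mul,
    integral_inv_sub_mul_deriv hrect hpos hz] at e
  rw [sub_eq_zero.1 e.symm, mul_comm]

/-- Powers `(z - w)⁻ʲ` with `j ≥ 2` have primitives, so their integrals along loops vanish. -/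
theorem integral_inv_pow_mul_deriv (hrect : AbsolutelyContinuousOnInterval C.extend 0 1) {w : ℂ}
    (hw : w ∉ range C) (j : ℕ) :
    ∫ t in (0 : ℝ)..1, ((C.extend t - w) ^ (j + 2))⁻¹ * deriv C.extend t = 0 := by
  rw [← image_extend_Icc, ← uIcc_zero_one] at hw
  -- The primitive is `-(ζ - w)^(-(j + 1)) / (j + 1)`, written as a polynomial in `u = (ζ - w)⁻¹`.
  have hac := (hrect.inv_sub hw).contDiff_comp (φ := fun u ↦ -u ^ (j + 1) / (j + 1)) (by fun_prop)
  rw [hac.integral_eq_sub_of_ae_hasDerivAt]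
  · simp
  · filter_upwards [hrect.ae_differentiableAt_complex] with t ht hm
    have hne : C.extend t - w ≠ 0 := fun h ↦ hw ⟨t, hm, sub_eq_zero.1 h⟩
    have d := ((((ht hm).hasDerivAt.sub_const w).inv hne).pow (j + 1)).neg.div_const ((j : ℂ) + 1)
    convert! d using 1
    have hj : (j : ℂ) + 1 ≠ 0 := Nat.cast_add_one_ne_zero j
    push_cast
    simp only [Pi.inv_apply]
    rw [inv_pow, pow_add]
    field_simp

theorem integral_inv_pow_div_sub_mul_deriv
    (hrect : AbsolutelyContinuousOnInterval C.extend 0 1) (hpos : IsPositivelyOriented C)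
    {w z : ℂ} (hw : w ∈ inside C) (hz : z ∈ inside C) (j : ℕ) :
    ∫ t in (0 : ℝ)..1, ((C.extend t - w) ^ (j + 1) * (C.extend t - z))⁻¹ * deriv C.extend t =
      0 := by
  rcases eq_or_ne z w with rfl | hne
  · simpa only [← pow_succ] using integral_inv_pow_mul_deriv hrect hz.1 j
  have hwC : w ∉ C.extend '' Icc 0 1 := image_extend_Icc C ▸ hw.1
  have hzC : z ∉ C.extend '' Icc 0 1 := image_extend_Icc C ▸ hz.1
  have cw : ∀ k : ℕ, ContinuousOn (fun t : ℂ ↦ ((t - w) ^ k)⁻¹) (C.extend '' Icc 0 1) := fun k ↦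
    ContinuousOn.inv₀ (by fun_prop) fun t ht ↦ pow_ne_zero k fun h ↦ hwC (sub_eq_zero.1 h ▸ ht)
  have cz := continuousOn_inv_sub hzC
  have i1 : ∀ k : ℕ, IntervalIntegrable
      (fun t ↦ ((C.extend t - w) ^ k)⁻¹ * deriv C.extend t) volume 0 1 := fun k ↦
    intervalIntegrable_mul_deriv hrect (cw k)
  have i2 : ∀ k : ℕ, IntervalIntegrable
      (fun t ↦ ((C.extend t - w) ^ k * (C.extend t - z))⁻¹ * deriv C.extend t) volume 0 1 :=
    fun k ↦ by
      simpa only [mul_inv] using intervalIntegrable_mul_deriv hrect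
        (f := fun t ↦ ((t - w) ^ k)⁻¹ * (t - z)⁻¹) ((cw k).mul cz)
  -- Partial fractions lower the power of `t - w` by one. At `k = 0` the two remaining integrals are
  -- both `2πi` and cancel.
  have step : ∀ k : ℕ,
      ∫ t in (0 : ℝ)..1, ((C.extend t - w) ^ (k + 1) * (C.extend t - z))⁻¹ * deriv C.extend t =
      (z - w)⁻¹ *
        ((∫ t in (0 : ℝ)..1, ((C.extend t - w) ^ k * (C.extend t - z))⁻¹ * deriv C.extend t) -
          ∫ t in (0 : ℝ)..1, ((C.extend t - w) ^ (k + 1))⁻¹ * deriv C.extend t) := fun k ↦ by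
    rw [← intervalIntegral.integral_sub (i2 k) (i1 (k + 1)), ← intervalIntegral.integral_const_mul]
    refine intervalIntegral.integral_congr fun t ht ↦ ?_
    rw [uIcc_zero_one] at ht
    have a1 : C.extend t - w ≠ 0 := fun h ↦ hwC ⟨t, ht, sub_eq_zero.1 h⟩
    have a2 : C.extend t - z ≠ 0 := fun h ↦ hzC ⟨t, ht, sub_eq_zero.1 h⟩
    have a3 : z - w ≠ 0 := sub_ne_zero.2 hne
    field_simp
    ring
  induction j with
  | zero =>
    rw [step]
    simp [integral_inv_sub_mul_deriv hrect hpos hz, integral_inv_sub_mul_deriv hrect hpos hw]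
  | succ j ih => rw [step, ih, integral_inv_pow_mul_deriv hrect hw.1 j, sub_zero, mul_zero]

end CurveIntegral

/-! ### The regular part at the pole. -/

section RegularPart

variable {G : ℂ → ℂ} {z₀ : ℂ} {p : ℕ} {g : ℤ → ℂ} {r : ℝ}

theorem eq_regularPart_add {z : ℂ} (hz : z ≠ z₀) :
    G z = regularPart G z₀ p g z + ∑ j ∈ Finset.Icc 1 p, g (-(j : ℤ)) / (z - z₀) ^ j := by
  rw [regularPart, if_neg hz, sub_add_cancel]

theorem IsLaurentExpansion.hasSum_regularPart (hg : IsLaurentExpansion G z₀ p g r) {z : ℂ}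
    (hz : ‖z - z₀‖ < r) :
    HasSum (fun j : ℕ ↦ g j * (z - z₀) ^ j) (regularPart G z₀ p g z) := by
  rcases eq_or_ne z z₀ with rfl | hne
  · rw [regularPart, if_pos rfl]
    -- At the centre only the term `j = 0` survives, as `0 ^ 0 = 1`.
    convert! hasSum_single (f := fun j : ℕ ↦ g j * (z - z) ^ j) 0 fun j hj ↦ by simp [hj] using 1
    simp
  have hsum := hg.hasSum z (norm_pos_iff.2 (sub_ne_zero.2 hne)) hz
  set F : ℤ → ℂ := fun j ↦ g j * (z - z₀) ^ j
  have hneg : HasSum (fun n : ℕ ↦ F (-(n + 1 : ℤ)))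
      (∑ j ∈ Finset.Icc 1 p, g (-(j : ℤ)) / (z - z₀) ^ j) := by
    have e : ∑ j ∈ Finset.Icc 1 p, g (-(j : ℤ)) / (z - z₀) ^ j =
        ∑ n ∈ Finset.range p, F (-(n + 1 : ℤ)) := by
      rw [Finset.range_eq_Ico, ← Finset.Ico_add_one_right_eq_Icc, ← zero_add 1,
        ← Finset.sum_Ico_add' (fun j : ℕ ↦ g (-(j : ℤ)) / (z - z₀) ^ j) 0 p 1]
      refine Finset.sum_congr rfl fun n _ ↦ ?_
      simp only [F]
      rw [zpow_neg, div_eq_mul_inv]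
      norm_cast
    rw [e]
    refine hasSum_sum_of_ne_finset_zero fun n hn ↦ ?_
    rw [Finset.mem_range, not_lt] at hn
    simp only [F]
    rw [hg.coeff_eq_zero _ (by omega), zero_mul]
  have hnat : Summable fun n : ℕ ↦ F n := hsum.summable.comp_injective Nat.cast_injective
  have htot := HasSum.of_nat_of_neg_add_one hnat.hasSum hneg
  -- The nonnegative and negative halves of the Laurent series add up to `G z`; cancelling the
  -- principal part identifies the nonnegative half.
  have huniq := htot.unique hsum
  rw [eq_regularPart_add (G := G) (p := p) (g := g) hne] at huniq
  rw [← add_right_cancel huniq]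
  simpa [F] using hnat.hasSum

theorem IsLaurentExpansion.analyticAt_regularPart (hr : 0 < r)
    (hg : IsLaurentExpansion G z₀ p g r) : AnalyticAt ℂ (regularPart G z₀ p g) z₀ := by
  refine ⟨FormalMultilinearSeries.ofScalars ℂ fun n : ℕ ↦ g n, hasFPowerSeriesAt_iff.2 ?_⟩
  filter_upwards [Metric.ball_mem_nhds (0 : ℂ) hr] with z hz
  have := hg.hasSum_regularPart (z := z₀ + z) (by simpa using hz)
  simpa [mul_comm, FormalMultilinearSeries.coeff_ofScalars] using this

theorem regularPart_eventuallyEq {z : ℂ} (hz : z ≠ z₀) :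
    regularPart G z₀ p g =ᶠ[𝓝 z]
      fun z ↦ G z - ∑ j ∈ Finset.Icc 1 p, g (-(j : ℤ)) / (z - z₀) ^ j := by
  filter_upwards [isOpen_ne.mem_nhds hz] with w hw
  rw [regularPart, if_neg hw]

theorem analyticAt_principalPart {z : ℂ} (hz : z ≠ z₀) :
    AnalyticAt ℂ (fun z ↦ ∑ j ∈ Finset.Icc 1 p, g (-(j : ℤ)) / (z - z₀) ^ j) z := by
  refine Finset.analyticAt_fun_sum _ fun j _ ↦ ?_
  exact analyticAt_const.div ((analyticAt_id.sub analyticAt_const).pow j)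
    (pow_ne_zero j (sub_ne_zero.2 hz))

end RegularPart

end ContourCauchy

theorem mainTheorem9 {x : ℂ} (C : Path x x)
    (hrect : AbsolutelyContinuousOnInterval C.extend 0 1)
    (hsimple : ContourCauchy.IsSimpleLoop C)
    (hpos : ContourCauchy.IsPositivelyOriented C)
    (G : ℂ → ℂ) (z₀ : ℂ) (hz₀ : z₀ ∈ ContourCauchy.inside C)
    (hanalytic : AnalyticOnNhd ℂ G (ContourCauchy.inside C \ {z₀}))
    (hcont : ContinuousOn G (closure (ContourCauchy.inside C) \ {z₀}))
    (p : ℕ) (hp : 1 ≤ p) (hpole : meromorphicOrderAt G z₀ = ((-(p : ℤ) : ℤ) : WithTop ℤ))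
    (g : ℤ → ℂ) (r₀ : ℝ) (hr₀ : 0 < r₀)
    (hg : ContourCauchy.IsLaurentExpansion G z₀ p g r₀) :
    (∀ z : ℂ, ‖z - z₀‖ < r₀ →
      HasSum (fun j : ℕ => g j * (z - z₀) ^ j) (ContourCauchy.regularPart G z₀ p g z)) ∧
    AnalyticOnNhd ℂ (ContourCauchy.regularPart G z₀ p g) (ContourCauchy.inside C) ∧
    ∀ z ∈ ContourCauchy.inside C,
      CurveIntegrable (ContourCauchy.dform fun t => G t / (t - z)) C ∧
      curveIntegral (ContourCauchy.dform fun t => G t / (t - z)) C =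
        2 * Real.pi * Complex.I * ContourCauchy.regularPart G z₀ p g z := by
  open ContourCauchy in
  have han : AnalyticOnNhd ℂ (regularPart G z₀ p g) (inside C) := fun z hz ↦ by
    rcases eq_or_ne z z₀ with rfl | hne
    · exact hg.analyticAt_regularPart hr₀
    · exact ((hanalytic z ⟨hz, hne⟩).sub (analyticAt_principalPart hne)).congr
        (regularPart_eventuallyEq hne).symm
  have hRc : ContinuousOn (regularPart G z₀ p g) (closure (inside C)) := fun z hz ↦ by
    rcases eq_or_ne z z₀ with rfl | hne
    · exact (hg.analyticAt_regularPart hr₀).continuousAt.continuousWithinAt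
    -- Deleting `z₀` does not change the neighbourhoods of a point `z ≠ z₀`.
    · have h1 : ContinuousWithinAt G (closure (inside C)) z :=
        by
        simpa only [ContinuousWithinAt, hne.nhdsWithin_sdiff_singleton] using hcont z ⟨hz, hne⟩
      exact (h1.sub (analyticAt_principalPart hne).continuousAt.continuousWithinAt).congr_of_eventuallyEq
        ((regularPart_eventuallyEq hne).filter_mono nhdsWithin_le_nhds)
        (regularPart_eventuallyEq hne).self_of_nhds
  refine ⟨fun z hz ↦ hg.hasSum_regularPart hz, han, fun z hz ↦ ?_⟩
  have hsub := range_subset_closure_inside hrect hsimple hpos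
  have hz₀C : ∀ t ∈ range C, t ≠ z₀ := fun t ht h ↦ hz₀.1 (h ▸ ht)
  have hzC : ∀ t ∈ range C, t - z ≠ 0 := fun t ht h ↦ hz.1 (sub_eq_zero.1 h ▸ ht)
  refine ⟨curveIntegrable_dform hrect (ContinuousOn.div
    (hcont.mono fun t ht ↦ ⟨hsub ht, hz₀C t ht⟩) (by fun_prop) hzC), ?_⟩
  have i1 := intervalIntegrable_mul_deriv hrect (f := fun t ↦ regularPart G z₀ p g t / (t - z)) (by
    rw [image_extend_Icc]
    exact (hRc.mono hsub).div (by fun_prop) hzC)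
  have i2 : ∀ j ∈ Finset.Icc 1 p, IntervalIntegrable (fun t ↦ g (-(j : ℤ)) *
      (((C.extend t - z₀) ^ j * (C.extend t - z))⁻¹ * deriv C.extend t)) volume 0 1 := fun j _ ↦ by
    refine (intervalIntegrable_mul_deriv hrect
      (f := fun t ↦ ((t - z₀) ^ j * (t - z))⁻¹) ?_).const_mul _
    rw [image_extend_Icc]
    exact ContinuousOn.inv₀ (by fun_prop) fun t ht ↦
      mul_ne_zero (pow_ne_zero j (sub_ne_zero.2 (hz₀C t ht))) (hzC t ht)
  have i3 : IntervalIntegrable (fun t ↦ ∑ j ∈ Finset.Icc 1 p, g (-(j : ℤ)) *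
      (((C.extend t - z₀) ^ j * (C.extend t - z))⁻¹ * deriv C.extend t)) volume 0 1 := by
    convert! IntervalIntegrable.sum _ i2 using 1
    ext t
    rw [Finset.sum_apply]
  rw [curveIntegral_dform]
  calc _ = ∫ t in (0 : ℝ)..1, (regularPart G z₀ p g (C.extend t) / (C.extend t - z) *
          deriv C.extend t + ∑ j ∈ Finset.Icc 1 p, g (-(j : ℤ)) *
            (((C.extend t - z₀) ^ j * (C.extend t - z))⁻¹ * deriv C.extend t)) := by
        refine intervalIntegral.integral_congr fun t ht ↦ ?_
        rw [uIcc_zero_one] at ht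
        have hm : C.extend t ∈ range C := image_extend_Icc C ▸ ⟨t, ht, rfl⟩
        rw [eq_regularPart_add (G := G) (p := p) (g := g) (hz₀C _ hm), add_div, add_mul, Finset.sum_div,
          Finset.sum_mul]
        congr 1
        refine Finset.sum_congr rfl fun j _ ↦ ?_
        rw [mul_inv]
        ring
    _ = _ := by
        rw [intervalIntegral.integral_add i1 i3,
          intervalIntegral.integral_finsetSum i2,
          integral_div_sub_mul_deriv hrect hsimple hpos hRc han.differentiableOn hz,
          Finset.sum_eq_zero, add_zero]
        intro j hj
        obtain ⟨k, rfl⟩ := Nat.exists_eq_add_of_le' (Finset.mem_Icc.1 hj).1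
        rw [intervalIntegral.integral_const_mul,
          integral_inv_pow_div_sub_mul_deriv hrect hpos hz₀ hz, mul_zero]
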